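/- Fix integers $m\ge 1$, $n\ge 0$ and a homogeneous basis $e_1,\dots,e_{m+n}$ of the complex superspace $\mathbb C^{m|n}$, in any order of parities $|a|:=|e_a|\in\{0,1\}$ ($m$ of them $0$ and $n$ of them $1$) with $|1|=0$. The Lie superalgebra $\mathfrak{gl}(m|n)$ has the basis $E_{ab}$ of parity $|a|+|b|$, acting on $\mathbb C^{m|n}$ by $E_{ab}e_c=\delta_{bc}e_a$. Let $\epsilon_a$ be the weights dual to the $E_{aa}$, $(\epsilon_a,\epsilon_b)=(-1)^{|a|}\delta_{ab}$, $\alpha_a=\epsilon_a-\epsilon_{a+1}$ and $F_a=E_{a+1,a}$ for $1\le a<m+n$. Let $\mu$ be a hook partition, i.e. a partition with $\mu_{m+1}\le n$, with conjugate $\mu'$, and let $V(\mu)$ be the corresponding irreducible polynomial module, i.e. the irreducible $\mathfrak{gl}(m|n)$-module with highest weight $\lambda=\sum_a\lambda_a\epsilon_a$ (annihilated by $E_{ab}$, $a<b$), where $$\lambda_a=\max\Big(0,\ \mu_{i}-\sum_{b<a}|b|\Big),\quad i=\#\{b\le a: |b|=0\},\quad\text{if } |a|=0,$$ $$\lambda_a=\max\Big(0,\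 \mu'_{j}-\sum_{b<a}(1-|b|)\Big),\quad j=\#\{b\le a: |b|=1\},\quad\text{if } |a|=1.$$ Let $v_\lambda$ be a highest weight vector of $V(\mu)$, let $v_1=e_1$, $v_2=v_\lambda$, $\lambda^{(1)}=\epsilon_1$, $\lambda^{(2)}=\lambda$, and let $z_1\neq z_2$ be complex numbers. On $\mathbb C^{m|n}\otimes V(\mu)$ put $$\mathcal H_1=\frac{\sum_{a,b}(-1)^{|b|}E^{(1)}_{ab}E^{(2)}_{ba}}{z_1-z_2},\qquad \mathcal H_2=\frac{\sum_{a,b}(-1)^{|b|}E^{(2)}_{ab}E^{(1)}_{ba}}{z_2-z_1},$$ where $E^{(1)}_{ab}(x\otimes y)=E_{ab}x\otimes y$ and $E^{(2)}_{ab}(x\otimes y)=(-1)^{(|a|+|b|)|x|}x\otimes E_{ab}y$. For each tuple $\boldsymbol l=(l_1,\dots,l_{m+n-1})$ of non-negative integers with sum $l$ fix a map $c:\{1,\dots,l\}\to\{1,\dots,m+n-1\}$ that takes each value $a$ exactly $l_a$ times. A *solution of the Bethe equations* is a pair $(\boldsymbol l,\boldsymbol t)$, $\boldsymbol t\in\mathbb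 C^l$, such that $$-\sum_{s=1}^2\frac{(\alpha_{c(i)},\lambda^{(s)})}{t_i-z_s}+\sum_{j\ne i}\frac{(\alpha_{c(i)},\alpha_{c(j)})}{t_i-t_j}=0,\qquad 1\le i\le l,$$ where terms with coefficient zero are absent and all denominators of the other terms are non-zero. For $t_1,\dots,t_l,z_1,z_2$ pairwise distinct, the weight function is $$w(\boldsymbol t)=\sum_{(\boldsymbol n^1,\boldsymbol n^2)}(-1)^{|\boldsymbol n|}\,\omega_{\boldsymbol n^1}(z_1)\,\omega_{\boldsymbol n^2}(z_2)\;F_{\boldsymbol n^1}v_1\otimes F_{\boldsymbol n^2}v_2,$$ the sum being over all arrangements of $1,\dots,l$ in a row that is cut into two (possibly empty) words $\boldsymbol n^1,\boldsymbol n^2$. Here, for a word $\boldsymbol k=(k_1,\dots,k_q)$, $F_{\boldsymbol k}=F_{c(k_1)}\cdots F_{c(k_q)}$ and $\omega_{\boldsymbol k}(z)=\big((t_{k_1}-t_{k_2})\cdots(t_{k_{q-1}}-t_{k_q})(t_{k_q}-z)\big)^{-1}$ (equal to $1$ if $q=0$), and $|\boldsymbol n|$ is the number of pairs $i<j$ with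 $F_{c(i)},F_{c(j)}$ both odd such that $j$ stands before $i$. If $(\boldsymbol l,\boldsymbol t)$ is a solution of the Bethe equations, $t_1,\dots,t_l,z_1,z_2$ are pairwise distinct and $w(\boldsymbol t)\ne0$, then $w(\boldsymbol t)$ is called the *Bethe vector* of this solution. **Proposition.** (i) $\mathcal H_1=-\mathcal H_2$; write $\mathcal H:=\mathcal H_1$. (ii) Every solution of the Bethe equations with $\boldsymbol l=(1,\dots,1,0,\dots,0)$ (with $s$ ones, $0\le s\le m+n-1$) has pairwise distinct $t_1,\dots,t_l,z_1,z_2$ and $w(\boldsymbol t)\neq0$, i.e. it has a Bethe vector. (iii) If $w,w'$ are the Bethe vectors of two distinct solutions $(\boldsymbol l,\boldsymbol t)\ne(\boldsymbol l',\boldsymbol t')$ of the Bethe equations, then $w$ and $w'$ are eigenvectors of $\mathcal H$ with distinct eigenvalues. -/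

import Mathlib

open scoped TensorProduct

noncomputable section

namespace SuperGaudin

/-- The sign `(-1)^x` of a parity `x ∈ ℤ/2`. -/
def sgn (x : ZMod 2) : ℂ := if x = 0 then 1 else -1

/-- A module over the complex Lie superalgebra `gl(m|n)`, where `m + n = r + 1` and where `p a` is
the parity of the basis vector `e_a` of `ℂ^{m|n}` (`p` takes `m` times the value `0` and `n` times
the value `1`).

The superspace structure `V = V₀ ⊕ V₁` is recorded by the grading operator `gr`, which is `(-1)^i`
on `V_i`: the parts are the eigenspaces `V₀ = ker (gr - 1)`, `V₁ = ker (gr + 1)`, and every linear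
involution of a complex vector space arises in this way. The operator `act a b` is the action of
`E_{ab}`; it has parity `p a + p b`, and the supercommutation relations of the basis `E_{ab}` of
`gl(m|n)` hold. -/
structure GLModule {r : ℕ} (p : Fin (r + 1) → ZMod 2) (V : Type*) [AddCommGroup V]
    [Module ℂ V] where
  gr : V →ₗ[ℂ] V
  act : Fin (r + 1) → Fin (r + 1) → V →ₗ[ℂ] V
  gr_gr : ∀ v, gr (gr v) = v
  act_gr : ∀ a b v, act a b (gr v) = sgn (p a + p b) • gr (act a b v)
  act_act : ∀ a b c d v,
    act a b (act c d v) - sgn ((p a + p b) * (p c + p d)) • act c d (act a b v) =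
      (if b = c then act a d v else 0) -
        sgn ((p a + p b) * (p c + p d)) • (if a = d then act c b v else 0)

/-- The defining representation `ℂ^{m|n}`: `e_a = Pi.single a 1` has parity `p a`, and
`E_{ab} e_c = δ_{bc} e_a`. -/
def defining {r : ℕ} (p : Fin (r + 1) → ZMod 2) : GLModule p (Fin (r + 1) → ℂ) where
  gr := LinearMap.pi fun a => sgn (p a) • LinearMap.proj a
  act a b := LinearMap.single ℂ (fun _ => ℂ) a ∘ₗ LinearMap.proj b
  gr_gr v := by
    ext a
    by_cases h : p a = 0 <;> simp [sgn, h]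
  act_gr a b v := by
    ext c
    have h2 : ∀ x : ZMod 2, x = 0 ∨ x = 1 := by decide
    by_cases hc : c = a
    · subst hc
      rcases h2 (p c) with h | h <;> rcases h2 (p b) with h' | h' <;>
        simp [sgn, h, h', show (1 : ZMod 2) + 1 = 0 from rfl]
    · simp [hc]
  act_act a b c d v := by
    ext x
    by_cases hbc : b = c <;> by_cases had : a = d <;> by_cases hx : x = a <;>
      by_cases hy : x = c <;> simp_all [Pi.single_apply]

/-- The highest weight vector `e_1` of the defining representation. -/
def e₁ (r : ℕ) : Fin (r + 1) → ℂ := Pi.single 0 1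

/-- `v` is a (homogeneous) highest weight vector of weight `∑ lam a • ε_a` in the module `M`, and
`M` is irreducible, i.e. `0` and `M` are its only graded submodules. This says that `M` is the
irreducible highest weight module `L(lam)` and that `v` is a highest weight vector of it. -/
structure IsIrreducibleHighestWeight {r : ℕ} {p : Fin (r + 1) → ZMod 2} {V : Type*}
    [AddCommGroup V] [Module ℂ V] (M : GLModule p V) (lam : Fin (r + 1) → ℂ) (v : V) : Prop where
  ne_zero : v ≠ 0
  homogeneous : M.gr v = v ∨ M.gr v = -v
  weight : ∀ a, M.act a a v = lam a • v
  raising : ∀ a b, a < b → M.act a b v = 0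
  irreducible : ∀ W : Submodule ℂ V, (∀ w ∈ W, M.gr w ∈ W) →
    (∀ a b, ∀ w ∈ W, M.act a b w ∈ W) → W = ⊥ ∨ W = ⊤

/-- The number of basis vectors of parity `x` that strictly precede `e_a`. -/
def before {r : ℕ} (p : Fin (r + 1) → ZMod 2) (x : ZMod 2) (a : Fin (r + 1)) : ℕ :=
  (Finset.univ.filter fun b => b < a ∧ p b = x).card

/-- The highest weight of the polynomial module `V(μ)` of a hook diagram `μ`. The components are
the numbers of boxes that are removed when the basis vectors are read in order, where an even one
removes the first remaining row and an odd one the first remaining column. Thus the component is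
`max 0 (μ_i - #{odd b < a})` if `e_a` is the `i`-th even vector, and
`max 0 (μ'_j - #{even b < a})` if `e_a` is the `j`-th odd vector. (The subtraction of natural
numbers is the truncated one on purpose, and rows and columns of `YoungDiagram` are counted from
zero.) -/
def hookWeight {r : ℕ} (p : Fin (r + 1) → ZMod 2) (μ : YoungDiagram) (a : Fin (r + 1)) : ℂ :=
  ((if p a = 0 then μ.rowLen (before p 0 a) - before p 1 a
    else μ.colLen (before p 1 a) - before p 0 a : ℕ) : ℂ)

/-- The weight `ε_a`. -/
def eps {r : ℕ} (a : Fin (r + 1)) : Fin (r + 1) → ℂ := Pi.single a 1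

/-- The simple root `α_a = ε_a - ε_{a+1}`. -/
def simpleRoot {r : ℕ} (a : Fin r) : Fin (r + 1) → ℂ := eps a.castSucc - eps a.succ

/-- The bilinear form on weights, `(ε_a, ε_b) = (-1)^{|a|} δ_{ab}`. -/
def form {r : ℕ} (p : Fin (r + 1) → ZMod 2) (x y : Fin (r + 1) → ℂ) : ℂ :=
  ∑ a, sgn (p a) * x a * y a

/-- The parity of the simple root vectors `E_a` and `F_a`. -/
def rootParity {r : ℕ} (p : Fin (r + 1) → ZMod 2) (a : Fin r) : ZMod 2 :=
  p a.castSucc + p a.succ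

/-- `t` solves the Bethe equations for two sites `z₁, z₂` with weights `lam₁, lam₂`, the variable
`t i` having the colour `c i`: every term whose coefficient is not zero has a denominator that is
not zero, and the equations hold. -/
structure IsBetheSolution {r L : ℕ} (p : Fin (r + 1) → ZMod 2) (lam₁ lam₂ : Fin (r + 1) → ℂ)
    (z₁ z₂ : ℂ) (c : Fin L → Fin r) (t : Fin L → ℂ) : Prop where
  ne_site₁ : ∀ i, form p (simpleRoot (c i)) lam₁ ≠ 0 → t i ≠ z₁
  ne_site₂ : ∀ i, form p (simpleRoot (c i)) lam₂ ≠ 0 → t i ≠ z₂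
  ne_root : ∀ i j, i ≠ j → form p (simpleRoot (c i)) (simpleRoot (c j)) ≠ 0 → t i ≠ t j
  equation : ∀ i,
    -(form p (simpleRoot (c i)) lam₁ / (t i - z₁) + form p (simpleRoot (c i)) lam₂ / (t i - z₂)) +
      ∑ j ∈ Finset.univ.erase i, form p (simpleRoot (c i)) (simpleRoot (c j)) / (t i - t j) = 0

/-- No denominator in the definition of the weight function vanishes. -/
def IsRegular {L : ℕ} (z₁ z₂ : ℂ) (t : Fin L → ℂ) : Prop :=
  Function.Injective t ∧ ∀ i, t i ≠ z₁ ∧ t i ≠ z₂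

/-- `1 / ((t_{n_1} - t_{n_2}) ⋯ (t_{n_{j-1}} - t_{n_j}) (t_{n_j} - z))`, and `1` for no `n`. -/
def omega {L : ℕ} (t : Fin L → ℂ) (z : ℂ) : List (Fin L) → ℂ
  | [] => 1
  | [i] => 1 / (t i - z)
  | i :: j :: s => 1 / (t i - t j) * omega t z (j :: s)

/-- The lowering operator `F_a = E_{a+1,a}`. -/
def GLModule.lower {r : ℕ} {p : Fin (r + 1) → ZMod 2} {V : Type*} [AddCommGroup V] [Module ℂ V]
    (M : GLModule p V) (a : Fin r) : V →ₗ[ℂ] V := M.act a.succ a.castSucc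

/-- `F_{c(n_1)} F_{c(n_2)} ⋯ F_{c(n_j)} v`. -/
def GLModule.word {r L : ℕ} {p : Fin (r + 1) → ZMod 2} {V : Type*} [AddCommGroup V] [Module ℂ V]
    (M : GLModule p V) (c : Fin L → Fin r) (s : List (Fin L)) (v : V) : V :=
  s.foldr (fun i u => M.lower (c i) u) v

/-- The sign of the arrangement `(n 0, n 1, …)` of the indices: a factor `-1` for each pair of
indices of odd lowering operators that do not stand in their natural order. -/
def arrangementSign {r L : ℕ} (p : Fin (r + 1) → ZMod 2) (c : Fin L → Fin r)
    (n : Equiv.Perm (Fin L)) : ℂ :=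
  ∏ x, ∏ y ∈ Finset.univ.filter (fun y => x < y ∧ n y < n x),
    sgn (rootParity p (c (n x)) * rootParity p (c (n y)))

/-- The weight function `w(z₁, z₂, t)` with values in the tensor product of two modules with
highest weight vectors `v₁`, `v₂`. The sum is over the ordered partitions of the index set into
two parts `(n 0, …, n (k-1); n k, …, n (L-1))`. -/
def weightFunction {r L : ℕ} {p : Fin (r + 1) → ZMod 2} {V₁ V₂ : Type*}
    [AddCommGroup V₁] [Module ℂ V₁] [AddCommGroup V₂] [Module ℂ V₂]
    (M₁ : GLModule p V₁) (M₂ : GLModule p V₂) (v₁ : V₁) (v₂ : V₂) (z₁ z₂ : ℂ)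
    (c : Fin L → Fin r) (t : Fin L → ℂ) : V₁ ⊗[ℂ] V₂ :=
  ∑ k ∈ Finset.range (L + 1), ∑ n : Equiv.Perm (Fin L),
    (arrangementSign p c n * (omega t z₁ ((List.ofFn n).take k) *
        omega t z₂ ((List.ofFn n).drop k))) •
      (M₁.word c ((List.ofFn n).take k) v₁ ⊗ₜ[ℂ] M₂.word c ((List.ofFn n).drop k) v₂)

section TwoSites

variable {r : ℕ} {p : Fin (r + 1) → ZMod 2} {V₁ V₂ : Type*}
  [AddCommGroup V₁] [Module ℂ V₁] [AddCommGroup V₂] [Module ℂ V₂]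

/-- `E_{ab}^{(1)} = E_{ab} ⊗ 1`. -/
def site₁ (M₁ : GLModule p V₁) (_M₂ : GLModule p V₂) (a b : Fin (r + 1)) :
    Module.End ℂ (V₁ ⊗[ℂ] V₂) :=
  TensorProduct.map (M₁.act a b) LinearMap.id

/-- `E_{ab}^{(2)} = 1 ⊗ E_{ab}`, with the super sign rule
`(1 ⊗ E_{ab}) (v ⊗ w) = (-1)^{|E_{ab}| |v|} v ⊗ E_{ab} w`. -/
def site₂ (M₁ : GLModule p V₁) (M₂ : GLModule p V₂) (a b : Fin (r + 1)) :
    Module.End ℂ (V₁ ⊗[ℂ] V₂) :=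
  TensorProduct.map (if p a + p b = 0 then LinearMap.id else M₁.gr) (M₂.act a b)

/-- The Gaudin Hamiltonian `H₁ = ∑_{a,b} (-1)^{|b|} E_{ab}^{(1)} E_{ba}^{(2)} / (z₁ - z₂)`. -/
def gaudin₁ (M₁ : GLModule p V₁) (M₂ : GLModule p V₂) (z₁ z₂ : ℂ) :
    Module.End ℂ (V₁ ⊗[ℂ] V₂) :=
  (1 / (z₁ - z₂)) • ∑ a, ∑ b, sgn (p b) • (site₁ M₁ M₂ a b * site₂ M₁ M₂ b a)

/-- The Gaudin Hamiltonian `H₂ = ∑_{a,b} (-1)^{|b|} E_{ab}^{(2)} E_{ba}^{(1)} / (z₂ - z₁)`. -/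
def gaudin₂ (M₁ : GLModule p V₁) (M₂ : GLModule p V₂) (z₁ z₂ : ℂ) :
    Module.End ℂ (V₁ ⊗[ℂ] V₂) :=
  (1 / (z₂ - z₁)) • ∑ a, ∑ b, sgn (p b) • (site₂ M₁ M₂ a b * site₁ M₁ M₂ b a)

end TwoSites

end SuperGaudin

end

/-!
The Hamiltonian is `1 / (z₁ - z₂)` times the Casimir operator `Ω = ∑ (-1)^{|b|} E_{ab} ⊗ E_{ba}`, which
commutes with `gl(m|n)`; part (i) is the symmetry of `Ω` under the exchange of the factors. Indices
are counted from zero.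

*Bethe vectors are singular.* The weight function is built by picking the lowering operators one
after the other (`wordSum`, `weightFunction_eq_outerSum`). Applying a simple raising operator removes
one letter, and the sum over the positions of that letter telescopes (`raise_wordSum`), which leaves
the left hand sides of the Bethe equations as coefficients. Hence the weight function of a regular
solution is killed by all raising operators (`raise_outerSum_eq_zero`).

*Singular vectors.* If `w = ∑ e_a ⊗ u_a` is a singular weight vector, its last non-zero component `u_b`
is singular in the irreducible module, so it has the highest weight `λ` and `w` has the weight
`λ + ε_b` (`exists_top_component`). As `Ω` commutes with `gl(m|n)`, this forces `w` to be an
eigenvector, and the eigenvalue, `content p λ b`, is read off from the last component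
(`casimir_eigenvector`). The weight `λ + ε_b` also says that the colours are `0, …, b - 1`, once
each (`colour_count_of_weight`).

*Solving the equations.* For such colours the Bethe equations are solved recursively. With
`x_0 = z₁ - z₂`, `x_{a+1} = t_a - z₂` they become `m_a x_{a+1} = (m_a - 1) x_a`, where `m_a` is, up to
the sign of the parity, the difference of the contents at `a` and at `b` (`chain_forward`). The
combinatorial core, `two_le_content_sub`, is that `m_a ≥ 2` as soon as there is a solution: the
solvability excludes those `b` for which no box can be added to the diagram. So the numbers `x_a`
have strictly decreasing absolute values, which gives regularity; they are unique; and contents for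
different `b` differ, which separates the eigenvalues. For regular solutions with these colours the
component of the weight function at `e_b` is a non-zero multiple of `v_λ` (`comp_outerSum`).
-/

open scoped TensorProduct

noncomputable section

namespace SuperGaudin

/-! ### The super sign rule on a tensor product -/

section

theorem sgn_zero : sgn 0 = 1 := by simp [sgn]

theorem sgn_add (x y : ZMod 2) : sgn (x + y) = sgn x * sgn y := by
  have h2 : ∀ x : ZMod 2, x = 0 ∨ x = 1 := by decide
  rcases h2 x with rfl | rfl <;> rcases h2 y with rfl | rfl <;>
    simp [sgn, show (1 : ZMod 2) + 1 = 0 from rfl]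

theorem sgn_mul_self (x : ZMod 2) : sgn x * sgn x = 1 := by
  by_cases h : x = 0 <;> simp [sgn, h]

theorem sgn_ne_zero (x : ZMod 2) : sgn x ≠ 0 := by
  by_cases h : x = 0 <;> simp [sgn, h]

theorem add_self_eq_zero' (x : ZMod 2) : x + x = 0 := CharTwo.add_self_eq_zero x

theorem mul_self_zmod2 (x : ZMod 2) : x * x = x := by
  revert x; decide

variable {r : ℕ} {p : Fin (r + 1) → ZMod 2}

section Relations

variable {V : Type*} [AddCommGroup V] [Module ℂ V]

/-- The supercommutation relations of `gl(m|n)` for a family `A` of operators, `A a b` standing for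
`E_{ab}`, in a form that allows to move `E_{ab}` to the right. -/
def IsGL (p : Fin (r + 1) → ZMod 2) (A : Fin (r + 1) → Fin (r + 1) → Module.End ℂ V) : Prop :=
  ∀ a b c d, A a b * A c d = sgn ((p a + p b) * (p c + p d)) • (A c d * A a b) +
    (if b = c then A a d else 0) -
      sgn ((p a + p b) * (p c + p d)) • (if a = d then A c b else 0)

theorem GLModule.isGL (M : GLModule p V) : IsGL p M.act := by
  intro a b c d
  ext v
  have h := M.act_act a b c d v
  have h' : M.act a b (M.act c d v) = sgn ((p a + p b) * (p c + p d)) • M.act c d (M.act a b v) +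
      (if b = c then M.act a d v else 0) -
        sgn ((p a + p b) * (p c + p d)) • (if a = d then M.act c b v else 0) := by
    rw [add_sub_assoc, ← h]; abel
  simp only [Module.End.mul_apply, LinearMap.sub_apply, LinearMap.add_apply, LinearMap.smul_apply]
  rw [h']
  split_ifs <;> simp

theorem GLModule.gr_act (M : GLModule p V) (a b : Fin (r + 1)) (v : V) :
    M.gr (M.act a b v) = sgn (p a + p b) • M.act a b (M.gr v) := by
  rw [M.act_gr, smul_smul, sgn_mul_self, one_smul]

/-- A vector killed by the simple raising operators is killed by all raising operators. -/
theorem IsGL.raising_of_simple {A : Fin (r + 1) → Fin (r + 1) → Module.End ℂ V} (hA : IsGL p A)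
    {v : V} (h : ∀ a : Fin r, A a.castSucc a.succ v = 0) {a b : Fin (r + 1)} (hab : a < b) :
    A a b v = 0 := by
  induction b using Fin.induction with
  | zero => exact absurd hab (Fin.not_lt_zero a)
  | succ b ih =>
    rcases (Fin.le_castSucc_iff.mpr hab).eq_or_lt with e | hlt
    · rw [e]; exact h b
    · have e := hA a b.castSucc b.castSucc b.succ
      have hne : a ≠ b.succ := ne_of_lt hab
      have e' := congrArg (fun f : Module.End ℂ V => f v) e
      simp only [Module.End.mul_apply, LinearMap.add_apply, LinearMap.smul_apply, if_neg hne,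
        if_true, h b, ih hlt, map_zero, smul_zero, zero_add, sub_zero] at e'
      exact e'.symm

/-- A submodule stable under `E_{aa}`, `E_{a,a+1}` and `E_{a+1,a}` is stable under `gl(m|n)`. -/
theorem IsGL.stable_of_simple {A : Fin (r + 1) → Fin (r + 1) → Module.End ℂ V} (hA : IsGL p A)
    {W : Submodule ℂ V} (h0 : ∀ a, ∀ w ∈ W, A a a w ∈ W)
    (hE : ∀ a : Fin r, ∀ w ∈ W, A a.castSucc a.succ w ∈ W)
    (hF : ∀ a : Fin r, ∀ w ∈ W, A a.succ a.castSucc w ∈ W) (a b : Fin (r + 1)) :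
    ∀ w ∈ W, A a b w ∈ W := by
  have key : ∀ (a b c : Fin (r + 1)), a ≠ c → (∀ w ∈ W, A a b w ∈ W) →
      (∀ w ∈ W, A b c w ∈ W) → ∀ w ∈ W, A a c w ∈ W := by
    intro a b c hac h1 h2 w hw
    have e' := congrArg (fun f : Module.End ℂ V => f w) (hA a b b c)
    simp only [Module.End.mul_apply, LinearMap.add_apply, LinearMap.smul_apply, if_neg hac,
      if_true, smul_zero, sub_zero] at e'
    have : A a c w = A a b (A b c w) - sgn ((p a + p b) * (p b + p c)) • A b c (A a b w) := by
      rw [e']; abel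
    rw [this]
    exact W.sub_mem (h1 _ (h2 _ hw)) (W.smul_mem _ (h2 _ (h1 _ hw)))
  rcases lt_trichotomy a b with hab | rfl | hab
  · induction b using Fin.induction with
    | zero => exact absurd hab (Fin.not_lt_zero a)
    | succ b ih =>
      rcases (Fin.le_castSucc_iff.mpr hab).eq_or_lt with e | hlt
      · rw [e]; exact hE b
      · exact key a b.castSucc b.succ (ne_of_lt hab) (ih hlt) (hE b)
  · exact h0 a
  · induction a using Fin.induction with
    | zero => exact absurd hab (Fin.not_lt_zero b)
    | succ a ih =>
      rcases (Fin.le_castSucc_iff.mpr hab).eq_or_lt with e | hlt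
      · rw [e]; exact hF a
      · exact key a.succ a.castSucc b (ne_of_gt hab) (hF a) (ih hlt)

/-- The grading operator to the power `x`. -/
def GLModule.twist (M : GLModule p V) (x : ZMod 2) : Module.End ℂ V :=
  if x = 0 then LinearMap.id else M.gr

theorem GLModule.twist_mul_twist (M : GLModule p V) (x y : ZMod 2) :
    M.twist x * M.twist y = M.twist (x + y) := by
  have h2 : ∀ x : ZMod 2, x = 0 ∨ x = 1 := by decide
  rcases h2 x with rfl | rfl <;> rcases h2 y with rfl | rfl <;> ext v <;>
    simp [GLModule.twist, show (1 : ZMod 2) + 1 = 0 from rfl, M.gr_gr]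

theorem GLModule.twist_mul_act (M : GLModule p V) (x : ZMod 2) (a b : Fin (r + 1)) :
    M.twist x * M.act a b = sgn (x * (p a + p b)) • (M.act a b * M.twist x) := by
  have h2 : ∀ x : ZMod 2, x = 0 ∨ x = 1 := by decide
  rcases h2 x with rfl | rfl <;> ext v
  · simp [GLModule.twist, sgn_zero]
  · simp [GLModule.twist, M.gr_act]

end Relations

section TwoSites

variable {V₁ V₂ : Type*} [AddCommGroup V₁] [Module ℂ V₁] [AddCommGroup V₂] [Module ℂ V₂]
  (M₁ : GLModule p V₁) (M₂ : GLModule p V₂)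

theorem site₂_eq (a b : Fin (r + 1)) :
    site₂ M₁ M₂ a b = TensorProduct.map (M₁.twist (p a + p b)) (M₂.act a b) := rfl

theorem isGL_site₁ : IsGL p (site₁ M₁ M₂) := by
  intro a b c d
  have e : ∀ a b c d, site₁ M₁ M₂ a b * site₁ M₁ M₂ c d =
      TensorProduct.map (M₁.act a b * M₁.act c d) LinearMap.id := by
    intro a b c d
    rw [site₁, site₁, ← TensorProduct.map_mul]; rfl
  rw [e, e, M₁.isGL a b c d]
  apply TensorProduct.ext'
  intro x y
  split_ifs <;> simp [site₁, TensorProduct.add_tmul, TensorProduct.sub_tmul,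
    TensorProduct.smul_tmul']

theorem isGL_site₂ : IsGL p (site₂ M₁ M₂) := by
  intro a b c d
  have e : ∀ a b c d, site₂ M₁ M₂ a b * site₂ M₁ M₂ c d =
      TensorProduct.map (M₁.twist ((p a + p b) + (p c + p d))) (M₂.act a b * M₂.act c d) := by
    intro a b c d
    rw [site₂_eq, site₂_eq, ← TensorProduct.map_mul, GLModule.twist_mul_twist]
  rw [e, e, M₂.isGL a b c d, add_comm (p c + p d)]
  have h1 : ∀ a b d : Fin (r + 1), (p a + p b) + (p b + p d) = p a + p d := by
    intro a b d
    have := add_self_eq_zero' (p b)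
    linear_combination this
  have h2 : ∀ a b c : Fin (r + 1), (p a + p b) + (p c + p a) = p c + p b := by
    intro a b c
    have := add_self_eq_zero' (p a)
    linear_combination this
  apply TensorProduct.ext'
  intro x y
  by_cases hbc : b = c <;> by_cases had : a = d
  · subst hbc had
    simp [site₂_eq, TensorProduct.tmul_add, TensorProduct.tmul_sub, add_self_eq_zero', h1]
  · subst hbc
    simp [site₂_eq, TensorProduct.tmul_add, h1, had]
  · subst had
    simp [site₂_eq, TensorProduct.tmul_sub, h2, hbc]
  · simp [hbc, had]

/-- The operators on different factors supercommute. -/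
theorem site₁_mul_site₂ (a b c d : Fin (r + 1)) :
    site₁ M₁ M₂ a b * site₂ M₁ M₂ c d =
      sgn ((p a + p b) * (p c + p d)) • (site₂ M₁ M₂ c d * site₁ M₁ M₂ a b) := by
  rw [site₁, site₂_eq, ← TensorProduct.map_mul, ← TensorProduct.map_mul, M₁.twist_mul_act,
    TensorProduct.map_smul_left, smul_smul, mul_comm (p c + p d), sgn_mul_self, one_smul]
  rfl

theorem site₂_mul_site₁ (a b c d : Fin (r + 1)) :
    site₂ M₁ M₂ a b * site₁ M₁ M₂ c d =
      sgn ((p a + p b) * (p c + p d)) • (site₁ M₁ M₂ c d * site₂ M₁ M₂ a b) := by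
  rw [site₁_mul_site₂, smul_smul, mul_comm (p c + p d), sgn_mul_self, one_smul]

/-- The action of `E_{ab}` on the tensor product. -/
def diag (a b : Fin (r + 1)) : Module.End ℂ (V₁ ⊗[ℂ] V₂) := site₁ M₁ M₂ a b + site₂ M₁ M₂ a b

theorem isGL_diag : IsGL p (diag M₁ M₂) := by
  intro a b c d
  have h1 := isGL_site₁ M₁ M₂ a b c d
  have h2 := isGL_site₂ M₁ M₂ a b c d
  have h3 := site₁_mul_site₂ M₁ M₂ a b c d
  have h4 := site₂_mul_site₁ M₁ M₂ a b c d
  have e : diag M₁ M₂ a b * diag M₁ M₂ c d =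
      site₁ M₁ M₂ a b * site₁ M₁ M₂ c d + site₂ M₁ M₂ a b * site₂ M₁ M₂ c d +
      site₁ M₁ M₂ a b * site₂ M₁ M₂ c d + site₂ M₁ M₂ a b * site₁ M₁ M₂ c d := by
    simp only [diag, mul_add, add_mul]; abel
  rw [e, h1, h2, h3, h4]
  simp only [diag, mul_add, add_mul, smul_add]
  split_ifs <;> simp only [smul_add, smul_zero] <;> abel

theorem gaudin₁_eq_neg_gaudin₂ (z₁ z₂ : ℂ) : gaudin₁ M₁ M₂ z₁ z₂ = -gaudin₂ M₁ M₂ z₁ z₂ := by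
  have h : ∑ a, ∑ b, sgn (p b) • (site₂ M₁ M₂ a b * site₁ M₁ M₂ b a) =
      ∑ a, ∑ b, sgn (p b) • (site₁ M₁ M₂ a b * site₂ M₁ M₂ b a) := by
    rw [Finset.sum_comm]
    refine Finset.sum_congr rfl fun a _ => Finset.sum_congr rfl fun b _ => ?_
    rw [site₂_mul_site₁, smul_smul, add_comm (p b), mul_self_zmod2, sgn_add, ← mul_assoc,
      sgn_mul_self, one_mul]
  have hz : 1 / (z₁ - z₂) = -(1 / (z₂ - z₁)) := by
    rw [← neg_sub z₂ z₁, one_div, one_div, inv_neg]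
  rw [gaudin₁, gaudin₂, h, hz]
  ext x y
  simp only [TensorProduct.AlgebraTensorModule.curry_apply, LinearMap.restrictScalars_self,
    TensorProduct.curry_apply, LinearMap.smul_apply, LinearMap.neg_apply, neg_smul]

end TwoSites

end

/-! ### Singular vectors of irreducible modules -/

section

variable {r : ℕ} {p : Fin (r + 1) → ZMod 2} {V : Type*} [AddCommGroup V] [Module ℂ V]

theorem IsGL.cartan_mul {A : Fin (r + 1) → Fin (r + 1) → Module.End ℂ V} (hA : IsGL p A)
    (a c d : Fin (r + 1)) : A a a * A c d = A c d * A a a + (eps c a - eps d a) • A c d := by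
  rw [hA a a c d, add_self_eq_zero', zero_mul, sgn_zero, one_smul, one_smul, sub_smul,
    add_sub_assoc]
  congr 2
  · by_cases h : a = c
    · subst h; simp [eps]
    · simp [eps, h]
  · by_cases h : a = d
    · subst h; simp [eps]
    · simp [eps, h]

theorem IsGL.cartan_mul_lower {A : Fin (r + 1) → Fin (r + 1) → Module.End ℂ V} (hA : IsGL p A)
    (a : Fin (r + 1)) (i : Fin r) : A a a * A i.succ i.castSucc =
      A i.succ i.castSucc * A a a - simpleRoot i a • A i.succ i.castSucc := by
  rw [hA.cartan_mul, simpleRoot, Pi.sub_apply, sub_smul, sub_smul]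
  abel

theorem IsGL.raise_mul_lower {A : Fin (r + 1) → Fin (r + 1) → Module.End ℂ V} (hA : IsGL p A)
    (a i : Fin r) : A a.castSucc a.succ * A i.succ i.castSucc =
      sgn (rootParity p a * rootParity p i) • (A i.succ i.castSucc * A a.castSucc a.succ) +
        (if a = i then A a.castSucc a.castSucc - sgn (rootParity p a) • A a.succ a.succ
          else 0) := by
  rw [hA, add_comm (p i.succ)]
  by_cases h : a = i
  · subst h
    simp [rootParity, mul_self_zmod2, add_sub_assoc]
  · simp [rootParity, h]

/-- The weights of the vectors `F_{s_1} F_{s_2} ⋯ v`. -/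
theorem GLModule.act_self_word (M : GLModule p V) {lam : Fin (r + 1) → ℂ} {v : V}
    (hv : ∀ a, M.act a a v = lam a • v) (s : List (Fin r)) (a : Fin (r + 1)) :
    M.act a a (M.word id s v) =
      (lam a - (s.map fun i => simpleRoot i a).sum) • M.word id s v := by
  induction s with
  | nil => simp [GLModule.word, hv]
  | cons i s ih =>
    have e := congrArg (fun f : Module.End ℂ V => f (M.word id s v))
      (M.isGL.cartan_mul_lower a i)
    simp only [Module.End.mul_apply, LinearMap.sub_apply, LinearMap.smul_apply, ih, map_smul] at e
    have e2 : M.word id (i :: s) v = M.act i.succ i.castSucc (M.word id s v) := rfl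
    rw [e2, e, ← sub_smul, List.map_cons, List.sum_cons]
    congr 1; ring

/-- In an irreducible module, a homogeneous highest weight vector generates the whole module under
the lowering operators. -/
theorem span_word_eq_top {M : GLModule p V} {lam : Fin (r + 1) → ℂ} {v : V}
    (irr : ∀ W : Submodule ℂ V, (∀ w ∈ W, M.gr w ∈ W) →
      (∀ a b, ∀ w ∈ W, M.act a b w ∈ W) → W = ⊥ ∨ W = ⊤)
    (h0 : v ≠ 0) (hgr : M.gr v = v ∨ M.gr v = -v) (hv : ∀ a, M.act a a v = lam a • v)
    (hE : ∀ a b, a < b → M.act a b v = 0) :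
    Submodule.span ℂ (Set.range fun s => M.word id s v) = ⊤ := by
  set W := Submodule.span ℂ (Set.range fun s => M.word id s v) with hW
  have mem : ∀ s, M.word id s v ∈ W := fun s => Submodule.subset_span ⟨s, rfl⟩
  have stable : ∀ f : Module.End ℂ V, (∀ s, f (M.word id s v) ∈ W) → ∀ w ∈ W, f w ∈ W := by
    intro f hf
    have : W ≤ W.comap f := by
      rw [hW, Submodule.span_le]
      rintro _ ⟨s, rfl⟩
      exact hf s
    exact this
  have hgrW : ∀ w ∈ W, M.gr w ∈ W := by
    refine stable _ fun s => ?_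
    induction s with
    | nil =>
      rcases hgr with h | h <;> simp only [GLModule.word, List.foldr_nil, h]
      · exact mem []
      · exact W.neg_mem (mem [])
    | cons i s ih =>
      have hF : ∀ w ∈ W, M.act i.succ i.castSucc w ∈ W :=
        stable _ fun s => mem (i :: s)
      have e2 : M.word id (i :: s) v = M.act i.succ i.castSucc (M.word id s v) := rfl
      rw [e2, M.gr_act]
      exact W.smul_mem _ (hF _ ih)
  have hF : ∀ i : Fin r, ∀ w ∈ W, M.act i.succ i.castSucc w ∈ W := fun i =>
    stable _ fun s => mem (i :: s)
  have hH : ∀ a, ∀ w ∈ W, M.act a a w ∈ W := by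
    refine fun a => stable _ fun s => ?_
    rw [M.act_self_word hv]
    exact W.smul_mem _ (mem s)
  have hR : ∀ i : Fin r, ∀ w ∈ W, M.act i.castSucc i.succ w ∈ W := by
    intro i
    refine stable _ fun s => ?_
    induction s with
    | nil =>
      simp only [GLModule.word, List.foldr_nil, hE _ _ i.castSucc_lt_succ, W.zero_mem]
    | cons j s ih =>
      have e := congrArg (fun f : Module.End ℂ V => f (M.word id s v))
        (M.isGL.raise_mul_lower i j)
      have e2 : M.word id (j :: s) v = M.act j.succ j.castSucc (M.word id s v) := rfl
      simp only [Module.End.mul_apply, LinearMap.add_apply, LinearMap.smul_apply] at e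
      rw [e2, e]
      refine W.add_mem (W.smul_mem _ (hF j _ ih)) ?_
      split_ifs
      · simp only [LinearMap.sub_apply, LinearMap.smul_apply]
        exact W.sub_mem (hH _ _ (mem s)) (W.smul_mem _ (hH _ _ (mem s)))
      · simp
  rcases irr W hgrW (M.isGL.stable_of_simple hH hR hF) with h | h
  · exact absurd ((Submodule.mem_bot ℂ).mp (h ▸ mem [])) h0
  · exact h

/-- The operator `∑ a E_{aa}`; a simple lowering operator raises its eigenvalue by one. -/
def GLModule.height (M : GLModule p V) : Module.End ℂ V := ∑ a : Fin (r + 1), ((a : ℕ) : ℂ) • M.act a a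

theorem GLModule.height_apply_of_weight (M : GLModule p V) {lam : Fin (r + 1) → ℂ} {v : V}
    (hv : ∀ a, M.act a a v = lam a • v) : M.height v = (∑ a : Fin (r + 1), ((a : ℕ) : ℂ) * lam a) • v := by
  simp [GLModule.height, LinearMap.sum_apply, hv, Finset.sum_smul, smul_smul]

theorem sum_height_simpleRoot (i : Fin r) :
    ∑ a : Fin (r + 1), ((a : ℕ) : ℂ) * simpleRoot i a = -1 := by
  simp [simpleRoot, eps, mul_sub, Finset.sum_sub_distrib, Pi.single_apply]

/-- An eigenvector of the height operator in an irreducible highest weight module: the eigenvalue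
exceeds the one of the highest weight vector by an integer, and it is a multiple of that vector if
they are equal. -/
theorem height_eigenvector {M : GLModule p V} {lam : Fin (r + 1) → ℂ} {v : V}
    (irr : ∀ W : Submodule ℂ V, (∀ w ∈ W, M.gr w ∈ W) →
      (∀ a b, ∀ w ∈ W, M.act a b w ∈ W) → W = ⊥ ∨ W = ⊤)
    (h0 : v ≠ 0) (hgr : M.gr v = v ∨ M.gr v = -v) (hv : ∀ a, M.act a a v = lam a • v)
    (hE : ∀ a b, a < b → M.act a b v = 0) {u : V} (hu0 : u ≠ 0) {h : ℂ}
    (hu : M.height u = h • u) :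
    (∃ N : ℕ, h = ∑ a : Fin (r + 1), ((a : ℕ) : ℂ) * lam a + N) ∧
      (h = ∑ a : Fin (r + 1), ((a : ℕ) : ℂ) * lam a → ∃ k : ℂ, u = k • v) := by
  set h₀ := ∑ a : Fin (r + 1), ((a : ℕ) : ℂ) * lam a with hh₀
  have word_mem : ∀ s : List (Fin r),
      M.word id s v ∈ M.height.eigenspace (h₀ + (s.length : ℂ)) := by
    intro s
    rw [Module.End.mem_eigenspace_iff, M.height_apply_of_weight (M.act_self_word hv s)]
    congr 1
    have : ∀ s : List (Fin r), ∑ a : Fin (r + 1), ((a : ℕ) : ℂ) *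
        (s.map fun i => simpleRoot i a).sum = -(s.length : ℂ) := by
      intro s
      induction s with
      | nil => simp
      | cons i s ih =>
        simp only [List.map_cons, List.sum_cons, mul_add, Finset.sum_add_distrib, ih,
          sum_height_simpleRoot, List.length_cons, Nat.cast_add, Nat.cast_one]
        ring
    simp only [mul_sub, Finset.sum_sub_distrib, this]
    ring
  have top : ∀ x : V, x ∈ Submodule.span ℂ {v} ⊔
      ⨆ N : ℕ, M.height.eigenspace (h₀ + ((N + 1 : ℕ) : ℂ)) := by
    intro x
    have hx : x ∈ Submodule.span ℂ (Set.range fun s => M.word id s v) := by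
      rw [span_word_eq_top irr h0 hgr hv hE]; trivial
    refine Submodule.span_le.mpr ?_ hx
    rintro _ ⟨s, rfl⟩
    rcases s with _ | ⟨i, s⟩
    · exact Submodule.mem_sup_left (Submodule.mem_span_singleton_self v)
    · refine Submodule.mem_sup_right (Submodule.mem_iSup_of_mem s.length ?_)
      simpa using word_mem (i :: s)
  have indep := Module.End.eigenspaces_iSupIndep M.height
  have disj : ∀ y ∈ M.height.eigenspace h,
      y ∈ (⨆ μ : ℂ, ⨆ _ : μ ≠ h, M.height.eigenspace μ) → y = 0 := fun y h1 h2 =>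
    (Submodule.disjoint_def.mp (indep h)) y h1 h2
  have humem : u ∈ M.height.eigenspace h := Module.End.mem_eigenspace_iff.mpr hu
  have hvmem : v ∈ M.height.eigenspace h₀ := by simpa [GLModule.word] using word_mem []
  have inSup : ∀ μ : ℂ, μ ≠ h → M.height.eigenspace μ ≤
      ⨆ μ : ℂ, ⨆ _ : μ ≠ h, M.height.eigenspace μ := fun μ hμ =>
    le_iSup_of_le μ (le_iSup_of_le hμ le_rfl)
  obtain ⟨x, hx, y, hy, hxy⟩ := Submodule.mem_sup.mp (top u)
  obtain ⟨k, rfl⟩ := Submodule.mem_span_singleton.mp hx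
  by_cases hN : ∃ N : ℕ, h = h₀ + ((N + 1 : ℕ) : ℂ)
  · obtain ⟨N, hN⟩ := hN
    refine ⟨⟨N + 1, hN⟩, fun e => ?_⟩
    rw [e] at hN
    have : ((N + 1 : ℕ) : ℂ) = 0 := by linear_combination -hN
    exact absurd this (Nat.cast_ne_zero.mpr (Nat.succ_ne_zero N))
  · have hy' : y ∈ ⨆ μ : ℂ, ⨆ _ : μ ≠ h, M.height.eigenspace μ := by
      refine (iSup_le fun N => inSup _ ?_) hy
      exact fun e => hN ⟨N, e.symm⟩
    by_cases e : h = h₀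
    · refine ⟨⟨0, by simp [e]⟩, fun _ => ⟨k, ?_⟩⟩
      have : y = 0 := by
        refine disj y ?_ hy'
        rw [eq_sub_iff_add_eq'.mpr hxy]
        exact Submodule.sub_mem _ humem (Submodule.smul_mem _ _ (e ▸ hvmem))
      rw [← hxy, this, add_zero]
    · refine absurd (disj u humem ?_) hu0
      rw [← hxy]
      exact Submodule.add_mem _ (Submodule.smul_mem _ _ (inSup _ (Ne.symm e) hvmem)) hy'

/-- Every non-zero vector of an irreducible highest weight module that is a weight vector and is
killed by the raising operators has the highest weight. -/
theorem IsIrreducibleHighestWeight.weight_unique {M : GLModule p V} {lam : Fin (r + 1) → ℂ}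
    {v : V} (hM : IsIrreducibleHighestWeight M lam v) {u : V} (hu0 : u ≠ 0)
    {κ : Fin (r + 1) → ℂ} (hu : ∀ a, M.act a a u = κ a • u)
    (hE : ∀ a b, a < b → M.act a b u = 0) : κ = lam := by
  have hom : ∀ u : V, u ≠ 0 → (M.gr u = u ∨ M.gr u = -u) → (∀ a, M.act a a u = κ a • u) →
      (∀ a b, a < b → M.act a b u = 0) → κ = lam := by
    intro u hu0 hgr hu hE
    obtain ⟨⟨N, hN⟩, h1⟩ := height_eigenvector hM.irreducible hM.ne_zero hM.homogeneous hM.weight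
      hM.raising hu0 (M.height_apply_of_weight hu)
    obtain ⟨⟨N', hN'⟩, -⟩ := height_eigenvector hM.irreducible hu0 hgr hu hE hM.ne_zero
      (M.height_apply_of_weight hM.weight)
    have : ((N + N' : ℕ) : ℂ) = 0 := by push_cast; linear_combination -hN - hN'
    have hN0 : N = 0 := by
      have := Nat.cast_eq_zero.mp this
      omega
    obtain ⟨k, hk⟩ := h1 (by rw [hN, hN0]; simp)
    funext a
    have e : κ a • u = lam a • u := by
      rw [← hu a, hk, map_smul, hM.weight a, smul_comm]
    exact smul_left_injective ℂ hu0 e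
  -- One of the two homogeneous components of `u` is not zero.
  by_cases h : u + M.gr u = 0
  · refine hom u hu0 (Or.inr ?_) hu hE
    rw [eq_neg_iff_add_eq_zero, add_comm]; exact h
  · refine hom (u + M.gr u) h (Or.inl ?_) (fun a => ?_) fun a b hab => ?_
    · rw [map_add, M.gr_gr, add_comm]
    · rw [map_add, M.act_gr, hu, add_self_eq_zero', sgn_zero, one_smul, map_smul, smul_add]
    · rw [map_add, M.act_gr, hE a b hab, map_zero, smul_zero, add_zero]

end

/-! ### Generating functions of words -/

section

section WordSum

variable {ι : Type*} [LinearOrder ι] {T : Type*} [AddCommGroup T] [Module ℂ T]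

/-- The sign for moving the `i`-th operator in front of those with index in `S`, in their natural
order. -/
def pickSign (π : ι → ZMod 2) (i : ι) (S : Finset ι) : ℂ :=
  ∏ j ∈ S.filter (· < i), sgn (π i * π j)

theorem pickSign_ne_zero (π : ι → ZMod 2) (i : ι) (S : Finset ι) : pickSign π i S ≠ 0 :=
  Finset.prod_ne_zero_iff.mpr fun _ _ => sgn_ne_zero _

theorem pickSign_erase (π : ι → ZMod 2) {i k : ι} {S : Finset ι} (hk : k ∈ S) :
    pickSign π i S = (if k < i then sgn (π i * π k) else 1) * pickSign π i (S.erase k) := by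
  rw [pickSign, pickSign, Finset.filter_erase]
  split_ifs with h
  · rw [Finset.mul_prod_erase _ (fun j => sgn (π i * π j)) (Finset.mem_filter.mpr ⟨hk, h⟩)]
  · rw [Finset.erase_eq_of_notMem (by simp [h]), one_mul]

/-- Exchange of the two operators that are picked first. -/
theorem pickSign_mul_pickSign (π : ι → ZMod 2) {i k : ι} {S : Finset ι} (hi : i ∈ S) (hk : k ∈ S)
    (hik : i ≠ k) : pickSign π k S * sgn (π i * π k) * pickSign π i (S.erase k) =
      pickSign π i S * pickSign π k (S.erase i) := by
  rw [pickSign_erase π (i := k) hi, pickSign_erase π (i := i) hk, mul_comm (π k)]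
  rcases lt_or_gt_of_ne hik with h | h
  · rw [if_pos h, if_neg h.not_gt]
    linear_combination pickSign π k (S.erase i) * pickSign π i (S.erase k) *
      sgn_mul_self (π i * π k)
  · rw [if_pos h, if_neg h.not_gt]
    ring

/-- The generating function of words in the operators `F`: the sum, over all ways to pick indices
`k_1, …, k_q` from `S` in a row and to leave over a subset `S'`, of the terms
`± F_{k_1} ⋯ F_{k_q} B(S') / ((x - y t_{k_1}) (t_{k_1} - t_{k_2}) ⋯ (t_{k_q} - z))`. The parameters
`x`, `y` cover both the absence (`x = 1`, `y = 0`) and the presence (`x = t_k`, `y = 1`) of a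
preceding letter. -/
def wordSum (π : ι → ZMod 2) (t : ι → ℂ) (z : ℂ) (F : ι → Module.End ℂ T) (B : Finset ι → T)
    (S : Finset ι) (x y : ℂ) : T :=
  (1 / (x - y * z)) • B S + ∑ i : S, (pickSign π (i : ι) S / (x - y * t i)) •
    F i (wordSum π t z F B (S.erase i) (t i) 1)
  termination_by S.card
  decreasing_by exact Finset.card_erase_lt_of_mem i.2

variable {π : ι → ZMod 2} {t : ι → ℂ} {z : ℂ} {F : ι → Module.End ℂ T} {B : Finset ι → T}

theorem wordSum_eq (S : Finset ι) (x y : ℂ) : wordSum π t z F B S x y =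
    (1 / (x - y * z)) • B S + ∑ i ∈ S, (pickSign π i S / (x - y * t i)) •
      F i (wordSum π t z F B (S.erase i) (t i) 1) := by
  rw [wordSum, Finset.sum_coe_sort S (fun i => (pickSign π i S / (x - y * t i)) •
    F i (wordSum π t z F B (S.erase i) (t i) 1))]

/-- The action of a simple raising operator `E` on a generating function of words: `χ` is the
indicator function of the colour of `E` and `H` is the Cartan element `[E, F]` of this colour. The
sum over all positions of a fixed letter `F_i` telescopes. -/
theorem raise_wordSum {E H : Module.End ℂ T} {ε : ZMod 2} {χ A θ : ι → ℂ} {η : ℂ}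
    (ht : Function.Injective t) (hz : ∀ i, t i ≠ z)
    (hχ : ∀ i, χ i ≠ 0 → π i = ε)
    (hBE : ∀ S, E (B S) = ∑ i ∈ S, (χ i * pickSign π i S *
      (θ i - ∑ j ∈ S.erase i, A j / (t i - t j))) • B (S.erase i))
    (hBH : ∀ S, H (B S) = η • B S)
    (hHF : ∀ k w, F k (H w) = H (F k w) + A k • F k w)
    (hEF : ∀ k w, E (F k w) = sgn (ε * π k) • F k (E w) + χ k • H w)
    (S : Finset ι) (x y : ℂ) (hS : ∀ i ∈ S, x - y * t i ≠ 0) (hxz : x - y * z ≠ 0) :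
    E (wordSum π t z F B S x y) = ∑ i ∈ S, (χ i * pickSign π i S) •
      ((θ i + η / (t i - z) - ∑ j ∈ S.erase i, A j / (t i - t j)) •
          wordSum π t z F B (S.erase i) x y +
        (y / (x - y * t i)) • H (wordSum π t z F B (S.erase i) x y)) := by
  induction S using Finset.strongInduction generalizing x y with
  | H S ih =>
  have hχ' : ∀ i k, χ i * sgn (ε * π k) = χ i * sgn (π i * π k) := by
    intro i k
    by_cases h : χ i = 0
    · simp [h]
    · rw [hχ i h]
  -- The vector that remains when `F_i` and `F_k` have been taken away.
  set Y : ι → ι → T := fun i k =>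
    F k (wordSum π t z F B ((S.erase i).erase k) (t k) 1) with hY
  set β : ι → ℂ := fun i => θ i + η / (t i - z) - ∑ j ∈ S.erase i, A j / (t i - t j) with hβ
  have first : ∀ k ∈ S, sgn (ε * π k) • F k (E (wordSum π t z F B (S.erase k) (t k) 1)) =
      ∑ i ∈ S.erase k, (χ i * sgn (π i * π k) * pickSign π i (S.erase k)) •
        (β i • Y i k + (1 / (t k - t i)) • H (Y i k)) := by
    intro k hk
    rw [ih (S.erase k) (Finset.erase_ssubset hk) (t k) 1
      (fun i hi => by
        rw [one_mul, sub_ne_zero]; exact fun h => (Finset.mem_erase.mp hi).1 (ht h.symm))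
      (by rw [one_mul, sub_ne_zero]; exact hz k), map_sum, Finset.smul_sum]
    refine Finset.sum_congr rfl fun i hi => ?_
    obtain ⟨hik, hiS⟩ := Finset.mem_erase.mp hi
    have hβi : θ i + η / (t i - z) - ∑ j ∈ (S.erase k).erase i, A j / (t i - t j) =
        β i + A k / (t i - t k) := by
      have := Finset.add_sum_erase (S.erase i) (fun j => A j / (t i - t j))
        (Finset.mem_erase.mpr ⟨Ne.symm hik, hk⟩)
      simp only [hβ]
      rw [← this, Finset.erase_right_comm]
      ring
    have hinv : 1 / (t k - t i) = -(1 / (t i - t k)) := by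
      rw [← neg_sub, one_div, one_div, inv_neg]
    rw [hβi, Finset.erase_right_comm, map_smul, map_add, map_smul, map_smul, hHF, smul_smul, one_mul,
      ← mul_assoc, mul_comm (sgn _), hχ', hinv]
    simp only [hY]
    module
  have lhs : E (wordSum π t z F B S x y) = ∑ i ∈ S, (χ i * pickSign π i S) •
      ((1 / (x - y * z) * (β i - η / (t i - z))) • B (S.erase i) +
        ∑ k ∈ S.erase i, (pickSign π k (S.erase i) / (x - y * t k)) •
          (β i • Y i k + (1 / (t k - t i)) • H (Y i k)) +
        (1 / (x - y * t i)) • H (wordSum π t z F B (S.erase i) (t i) 1)) := by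
    have swap : ∑ k ∈ S, (pickSign π k S / (x - y * t k)) • (sgn (ε * π k) •
        F k (E (wordSum π t z F B (S.erase k) (t k) 1))) =
        ∑ i ∈ S, (χ i * pickSign π i S) • ∑ k ∈ S.erase i,
          (pickSign π k (S.erase i) / (x - y * t k)) •
          (β i • Y i k + (1 / (t k - t i)) • H (Y i k)) := by
      rw [Finset.sum_congr rfl fun k hk => by rw [first k hk]]
      simp only [Finset.smul_sum]
      rw [Finset.sum_comm' (s' := fun i => S.erase i) (t' := S)
        (by simp only [Finset.mem_erase]; tauto)]
      refine Finset.sum_congr rfl fun i hi => Finset.sum_congr rfl fun k hk => ?_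
      obtain ⟨hki, hkS⟩ := Finset.mem_erase.mp hk
      rw [smul_smul, smul_smul]
      congr 1
      linear_combination (χ i / (x - y * t k)) * pickSign_mul_pickSign π hi hkS (Ne.symm hki)
    have step : ∀ k, E ((pickSign π k S / (x - y * t k)) •
        F k (wordSum π t z F B (S.erase k) (t k) 1)) =
        (pickSign π k S / (x - y * t k)) • (sgn (ε * π k) •
          F k (E (wordSum π t z F B (S.erase k) (t k) 1))) +
        (pickSign π k S / (x - y * t k)) • χ k • H (wordSum π t z F B (S.erase k) (t k) 1) :=
      fun k => by rw [map_smul, hEF, smul_add]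
    have split : ∀ (f : ι → ℂ) (X Y Z : ι → T), ∑ i ∈ S, f i • (X i + Y i + Z i) =
        ∑ i ∈ S, f i • X i + (∑ i ∈ S, f i • Y i + ∑ i ∈ S, f i • Z i) := by
      intro f X Y Z
      simp only [smul_add, Finset.sum_add_distrib, add_assoc]
    rw [wordSum_eq, map_add, map_smul, map_sum, hBE, Finset.sum_congr rfl fun k _ => step k,
      Finset.sum_add_distrib, swap, split]
    congr 1
    · rw [Finset.smul_sum]
      refine Finset.sum_congr rfl fun i _ => ?_
      rw [smul_smul, smul_smul]
      congr 1
      simp only [hβ]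
      ring
    · congr 1
      refine Finset.sum_congr rfl fun i _ => ?_
      rw [smul_smul, smul_smul]
      congr 1
      ring
  rw [lhs]
  refine Finset.sum_congr rfl fun i hi => ?_
  congr 1
  have hxi := hS i hi
  have hiz : t i - z ≠ 0 := sub_ne_zero.mpr (hz i)
  rw [wordSum_eq (S.erase i) (t i) 1, wordSum_eq (S.erase i) x y]
  simp only [map_add, map_smul, map_sum, hBH, smul_add, Finset.smul_sum, smul_smul]
  have e1 : ∀ k ∈ S.erase i, (pickSign π k (S.erase i) / (x - y * t k) * (1 / (t k - t i))) •
      H (Y i k) + (1 / (x - y * t i) * (pickSign π k (S.erase i) / (t i - 1 * t k))) • H (Y i k) =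
      (y / (x - y * t i) * (pickSign π k (S.erase i) / (x - y * t k))) • H (Y i k) := by
    intro k hk
    obtain ⟨hki, hkS⟩ := Finset.mem_erase.mp hk
    have hxk := hS k hkS
    have h1 : t k - t i ≠ 0 := sub_ne_zero.mpr fun h => hki (ht h)
    have h2 : t i - t k ≠ 0 := sub_ne_zero.mpr fun h => hki (ht h.symm)
    rw [← add_smul]
    congr 1
    rw [one_mul]
    have h3 : t k - t i = -(t i - t k) := by ring
    rw [h3]
    field_simp
    ring
  have e2 : (1 / (x - y * z) * (β i - η / (t i - z))) • B (S.erase i) +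
      (1 / (x - y * t i) * (1 / (t i - 1 * z) * η)) • B (S.erase i) =
      (β i * (1 / (x - y * z))) • B (S.erase i) +
        (y / (x - y * t i) * (1 / (x - y * z) * η)) • B (S.erase i) := by
    rw [← add_smul, ← add_smul]
    congr 1
    rw [one_mul]
    field_simp
    ring
  rw [← Finset.sum_congr rfl e1, Finset.sum_add_distrib, Finset.sum_add_distrib]
  have e3 : ∀ k ∈ S.erase i, (pickSign π k (S.erase i) / (x - y * t k) * β i) • Y i k =
      (β i * (pickSign π k (S.erase i) / (x - y * t k))) • Y i k := fun k _ => by rw [mul_comm]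
  rw [Finset.sum_congr rfl e3]
  rw [eq_sub_of_add_eq e2]
  abel

/-- An operator for which `F i` has weight `-d i` acts on a generating function of words by a
scalar. -/
theorem weight_wordSum {D : Module.End ℂ T} {d : ι → ℂ} {κ : ℂ}
    (hB : ∀ S, D (B S) = (κ - ∑ i ∈ S, d i) • B S)
    (hF : ∀ k w, D (F k w) = F k (D w) - d k • F k w) (S : Finset ι) (x y : ℂ) :
    D (wordSum π t z F B S x y) = (κ - ∑ i ∈ S, d i) • wordSum π t z F B S x y := by
  induction S using Finset.strongInduction generalizing x y with
  | H S ih =>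
  rw [wordSum_eq, map_add, map_smul, hB, map_sum, smul_add, smul_comm, Finset.smul_sum]
  congr 1
  refine Finset.sum_congr rfl fun k hk => ?_
  have hs : κ - ∑ i ∈ S.erase k, d i - d k = κ - ∑ i ∈ S, d i := by
    rw [← Finset.add_sum_erase S d hk]
    ring
  rw [map_smul, hF, ih _ (Finset.erase_ssubset hk), map_smul, ← sub_smul, hs, smul_comm]

end WordSum

end

/-! ### The weight function as an iterated generating function -/

section

section ListSum

/-- The lists that contain each element of `S` once and nothing else. -/
def arrangements {ι : Type*} (S : Finset ι) : Finset (List ι) :=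
  ⟨Multiset.lists S.val, Multiset.lists_nodup_finset S⟩

theorem mem_arrangements {ι : Type*} {S : Finset ι} {s : List ι} : s ∈ arrangements S ↔ S.val = ↑s :=
  Multiset.mem_lists_iff _ _

theorem sum_arrangements_eq_sum_cons {ι X : Type*} [LinearOrder ι] [AddCommMonoid X]
    {S : Finset ι} (hS : S.Nonempty) (f : List ι → X) :
    ∑ s ∈ arrangements S, f s =
      ∑ i ∈ S, ∑ s ∈ arrangements (S.erase i), f (i :: s) := by
  have h : arrangements S = S.biUnion fun i =>
      (arrangements (S.erase i)).image (List.cons i) := by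
    ext s
    simp only [mem_arrangements, Finset.mem_biUnion, Finset.mem_image, Finset.erase_val]
    constructor
    · intro h
      rcases s with _ | ⟨i, s⟩
      · exact absurd (Finset.val_eq_zero.mp h) hS.ne_empty
      · have hi : i ∈ S := by
          rw [← Finset.mem_val, h]; simp
        exact ⟨i, hi, s, by rw [h]; simp, rfl⟩
    · rintro ⟨i, hi, s, hs, rfl⟩
      rw [← Multiset.cons_erase (Finset.mem_val.mpr hi), hs]
      rfl
  rw [h, Finset.sum_biUnion]
  · refine Finset.sum_congr rfl fun i _ => Finset.sum_image fun a _ b _ hab => ?_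
    exact List.cons_injective hab
  · intro i _ j _ hij
    simp only [Function.onFun, Finset.disjoint_left, Finset.mem_image]
    rintro _ ⟨s, -, rfl⟩ ⟨s', -, h⟩
    exact hij (List.cons.inj h).1.symm

theorem arrangements_empty {ι : Type*} : arrangements (∅ : Finset ι) = {[]} := by
  ext s
  rw [mem_arrangements, Finset.mem_singleton, Finset.empty_val, eq_comm]
  exact Multiset.coe_eq_zero s

theorem sum_perm_eq_sum_arrangements {X : Type*} [AddCommMonoid X] {L : ℕ}
    (f : List (Fin L) → X) :
    ∑ n : Equiv.Perm (Fin L), f (List.ofFn n) =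
      ∑ s ∈ arrangements (Finset.univ : Finset (Fin L)), f s := by
  refine Finset.sum_nbij (fun n => List.ofFn n) (fun n _ => ?_) (fun n _ n' _ h => ?_)
    (fun s hs => ?_) fun n _ => rfl
  · rw [mem_arrangements]
    refine (Multiset.Nodup.ext Finset.univ.nodup ?_).mpr fun i => ?_
    · exact List.nodup_ofFn.mpr n.injective
    · simp only [Finset.mem_val, Finset.mem_univ, true_iff]
      exact List.mem_ofFn.mpr ⟨n.symm i, by simp⟩
  · exact Equiv.coe_fn_injective (List.ofFn_injective h)
  · have hs := mem_arrangements.mp hs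
    have nd : s.Nodup := by
      have := (Finset.univ : Finset (Fin L)).nodup
      rw [hs] at this
      exact this
    have mem : ∀ i, i ∈ s := fun i => by
      have : i ∈ (Finset.univ : Finset (Fin L)).val := Finset.mem_univ i
      rw [hs] at this
      exact this
    have len : s.length = L := by
      have := congrArg Multiset.card hs
      simpa using this.symm
    refine ⟨(finCongr len.symm).trans (nd.getEquivOfForallMemList s mem), Finset.mem_univ _, ?_⟩
    refine List.ext_get (by simp [len]) fun k h1 h2 => ?_
    simp

variable {ι : Type*} [LinearOrder ι] {T : Type*} [AddCommGroup T] [Module ℂ T]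

/-- The sign of an arrangement of indices, as a function of the list. -/
def listSign (π : ι → ZMod 2) : List ι → ℂ
  | [] => 1
  | i :: s => (s.map fun j => if j < i then sgn (π i * π j) else 1).prod * listSign π s

theorem listSign_cons (π : ι → ZMod 2) {i : ι} {S : Finset ι} (hi : i ∈ S) {s : List ι}
    (hs : s ∈ arrangements (S.erase i)) :
    listSign π (i :: s) = pickSign π i S * listSign π s := by
  have hs := mem_arrangements.mp hs
  have e : pickSign π i (S.erase i) =
      (s.map fun j => if j < i then sgn (π i * π j) else 1).prod := by
    rw [pickSign, Finset.prod_filter, Finset.prod, hs]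
    rfl
  rw [pickSign_erase π hi, if_neg (lt_irrefl i), one_mul, e, listSign]

theorem prod_inversions_eq_listSign (π : ι → ZMod 2) {L : ℕ} (n : Fin L → ι) :
    ∏ x, ∏ y ∈ Finset.univ.filter (fun y => x < y ∧ n y < n x), sgn (π (n x) * π (n y)) =
      listSign π (List.ofFn n) := by
  induction L with
  | zero => simp [listSign]
  | succ L ih =>
    have := ih fun x => n x.succ
    simp only [Finset.prod_filter] at this ⊢
    simp only [Fin.prod_univ_succ (n := L), List.ofFn_succ, listSign, ← this, List.map_ofFn,
      List.prod_ofFn]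
    simp [Fin.succ_lt_succ_iff, Fin.succ_pos]

/-- The product of the inverse differences of a word whose first letter is preceded by the factor
`1 / (x - y t)`. -/
def chain (t : ι → ℂ) (z : ℂ) : ℂ → ℂ → List ι → ℂ
  | x, y, [] => 1 / (x - y * z)
  | x, y, i :: s => 1 / (x - y * t i) * chain t z (t i) 1 s

theorem omega_eq_chain {L : ℕ} (t : Fin L → ℂ) (z : ℂ) (s : List (Fin L)) :
    omega t z s = chain t z 1 0 s := by
  have h : ∀ (s : List (Fin L)) i, omega t z (i :: s) = chain t z (t i) 1 s := by
    intro s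
    induction s with
    | nil => intro i; simp [omega, chain]
    | cons j s ih => intro i; rw [omega, ih, chain, one_mul]
  rcases s with _ | ⟨i, s⟩
  · simp [omega, chain]
  · rw [h, chain]; simp

/-- `F_{s_1} F_{s_2} ⋯ u`. -/
def opWord (F : ι → Module.End ℂ T) (s : List ι) (u : T) : T := s.foldr (fun i w => F i w) u

variable {π : ι → ZMod 2} {t : ι → ℂ} {z : ℂ} {F : ι → Module.End ℂ T}

theorem wordSum_eq_sum_arrangements (u : T) (S : Finset ι) (x y : ℂ) :
    wordSum π t z F (fun S => if S = ∅ then u else 0) S x y =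
      ∑ s ∈ arrangements S, (listSign π s * chain t z x y s) • opWord F s u := by
  induction S using Finset.strongInduction generalizing x y with
  | H S ih =>
  rcases S.eq_empty_or_nonempty with rfl | hS
  · rw [wordSum_eq, arrangements_empty]
    simp [listSign, chain, opWord]
  · rw [wordSum_eq, sum_arrangements_eq_sum_cons hS, if_neg hS.ne_empty, smul_zero, zero_add]
    refine Finset.sum_congr rfl fun i hi => ?_
    rw [ih _ (Finset.erase_ssubset hi), map_sum, Finset.smul_sum]
    refine Finset.sum_congr rfl fun s hs => ?_
    rw [map_smul, smul_smul, listSign_cons π hi hs, chain]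
    change _ = _ • F i (opWord F s u)
    congr 1
    ring

theorem wordSum_wordSum_eq_sum_arrangements {z' : ℂ} {F' : ι → Module.End ℂ T} (u : T) (S : Finset ι)
    (x y : ℂ) :
    wordSum π t z F (fun S => wordSum π t z' F' (fun S => if S = ∅ then u else 0) S 1 0) S x y =
      ∑ s ∈ arrangements S, ∑ k ∈ Finset.range (s.length + 1),
        (listSign π s * (chain t z x y (s.take k) * chain t z' 1 0 (s.drop k))) •
          opWord F (s.take k) (opWord F' (s.drop k) u) := by
  induction S using Finset.strongInduction generalizing x y with
  | H S ih =>
  have h0 : (1 / (x - y * z)) • wordSum π t z' F' (fun S => if S = ∅ then u else 0) S 1 0 =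
      ∑ s ∈ arrangements S, (listSign π s * (chain t z x y (s.take 0) *
        chain t z' 1 0 (s.drop 0))) • opWord F (s.take 0) (opWord F' (s.drop 0) u) := by
    rw [wordSum_eq_sum_arrangements, Finset.smul_sum]
    refine Finset.sum_congr rfl fun s _ => ?_
    rw [smul_smul, List.take_zero, List.drop_zero, chain]
    change _ = _ • opWord F' s u
    congr 1
    ring
  simp only [Finset.sum_range_succ' _ (List.length _)]
  rw [wordSum_eq, h0, Finset.sum_add_distrib, add_comm]
  congr 1
  rcases S.eq_empty_or_nonempty with rfl | hS
  · rw [arrangements_empty]; simp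
  · rw [sum_arrangements_eq_sum_cons hS]
    refine Finset.sum_congr rfl fun i hi => ?_
    rw [ih _ (Finset.erase_ssubset hi), map_sum, Finset.smul_sum]
    refine Finset.sum_congr rfl fun s hs => ?_
    rw [map_sum, Finset.smul_sum, List.length_cons]
    refine Finset.sum_congr rfl fun k _ => ?_
    rw [map_smul, smul_smul, listSign_cons π hi hs, List.take_succ_cons, List.drop_succ_cons,
      chain]
    change _ = _ • F i (opWord F _ _)
    congr 1
    ring

end ListSum

section WeightFunction

variable {r L : ℕ} {p : Fin (r + 1) → ZMod 2} {V₁ V₂ : Type*}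
  [AddCommGroup V₁] [Module ℂ V₁] [AddCommGroup V₂] [Module ℂ V₂]

/-- The second part of the weight function: words in the lowering operators of the second factor,
applied to `u`. -/
def innerSum (M₁ : GLModule p V₁) (M₂ : GLModule p V₂) (z₂ : ℂ) (c : Fin L → Fin r)
    (t : Fin L → ℂ) (u : V₁ ⊗[ℂ] V₂) : Finset (Fin L) → V₁ ⊗[ℂ] V₂ := fun S =>
  wordSum (fun i => rootParity p (c i)) t z₂ (fun i => site₂ M₁ M₂ (c i).succ (c i).castSucc)
    (fun S => if S = ∅ then u else 0) S 1 0

/-- The weight function on a subset of the variables, with an additional factor at the first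
letter. -/
def outerSum (M₁ : GLModule p V₁) (M₂ : GLModule p V₂) (z₁ z₂ : ℂ) (c : Fin L → Fin r)
    (t : Fin L → ℂ) (u : V₁ ⊗[ℂ] V₂) : Finset (Fin L) → ℂ → ℂ → V₁ ⊗[ℂ] V₂ :=
  wordSum (fun i => rootParity p (c i)) t z₁ (fun i => site₁ M₁ M₂ (c i).succ (c i).castSucc)
    (innerSum M₁ M₂ z₂ c t u)

theorem weightFunction_eq_outerSum (M₁ : GLModule p V₁) (M₂ : GLModule p V₂) {v₁ : V₁} (v₂ : V₂)
    (hv₁ : M₁.gr v₁ = v₁) (z₁ z₂ : ℂ) (c : Fin L → Fin r) (t : Fin L → ℂ) :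
    weightFunction M₁ M₂ v₁ v₂ z₁ z₂ c t =
      outerSum M₁ M₂ z₁ z₂ c t (v₁ ⊗ₜ[ℂ] v₂) Finset.univ 1 0 := by
  have h2 : ∀ s : List (Fin L),
      opWord (fun i => site₂ M₁ M₂ (c i).succ (c i).castSucc) s (v₁ ⊗ₜ[ℂ] v₂) =
        v₁ ⊗ₜ[ℂ] M₂.word c s v₂ := by
    intro s
    induction s with
    | nil => rfl
    | cons i s ih =>
      change site₂ M₁ M₂ (c i).succ (c i).castSucc (opWord _ s _) = _
      rw [ih, site₂_eq, TensorProduct.map_tmul]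
      have : ∀ x, M₁.twist x v₁ = v₁ := by
        intro x
        unfold GLModule.twist
        split_ifs
        · rfl
        · exact hv₁
      rw [this]
      rfl
  have h1 : ∀ (s : List (Fin L)) (y : V₂),
      opWord (fun i => site₁ M₁ M₂ (c i).succ (c i).castSucc) s (v₁ ⊗ₜ[ℂ] y) =
        M₁.word c s v₁ ⊗ₜ[ℂ] y := by
    intro s y
    induction s with
    | nil => rfl
    | cons i s ih =>
      change site₁ M₁ M₂ (c i).succ (c i).castSucc (opWord _ s _) = _
      rw [ih, site₁, TensorProduct.map_tmul]
      rfl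
  rw [weightFunction, Finset.sum_comm, outerSum]
  unfold innerSum
  rw [wordSum_wordSum_eq_sum_arrangements, ← sum_perm_eq_sum_arrangements]
  refine Finset.sum_congr rfl fun n _ => ?_
  rw [List.length_ofFn]
  refine Finset.sum_congr rfl fun k _ => ?_
  rw [h2, h1, omega_eq_chain, omega_eq_chain, arrangementSign,
    prod_inversions_eq_listSign (fun i => rootParity p (c i)) n]

end WeightFunction

end

/-! ### The weight function is singular -/

section

variable {r : ℕ} {p : Fin (r + 1) → ZMod 2}

theorem form_simpleRoot (a : Fin r) (x : Fin (r + 1) → ℂ) : form p (simpleRoot a) x =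
    sgn (p a.castSucc) * x a.castSucc - sgn (p a.succ) * x a.succ := by
  simp [form, simpleRoot, eps, mul_sub, sub_mul, Finset.sum_sub_distrib, Pi.single_apply]

theorem sgn_mul_form_simpleRoot (a : Fin r) (x : Fin (r + 1) → ℂ) :
    sgn (p a.castSucc) * form p (simpleRoot a) x =
      x a.castSucc - sgn (rootParity p a) * x a.succ := by
  rw [form_simpleRoot, rootParity, sgn_add]
  linear_combination x a.castSucc * sgn_mul_self (p a.castSucc)

section Coroot

variable {V : Type*} [AddCommGroup V] [Module ℂ V]

/-- The supercommutator of `E_{a,a+1}` and `E_{a+1,a}`. -/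
def coroot (p : Fin (r + 1) → ZMod 2) (A : Fin (r + 1) → Fin (r + 1) → Module.End ℂ V)
    (a : Fin r) : Module.End ℂ V :=
  A a.castSucc a.castSucc - sgn (rootParity p a) • A a.succ a.succ

theorem coroot_apply_of_weight {A : Fin (r + 1) → Fin (r + 1) → Module.End ℂ V}
    {lam : Fin (r + 1) → ℂ} {v : V} (hv : ∀ a, A a a v = lam a • v) (a : Fin r) :
    coroot p A a v = (sgn (p a.castSucc) * form p (simpleRoot a) lam) • v := by
  rw [sgn_mul_form_simpleRoot, coroot, LinearMap.sub_apply, LinearMap.smul_apply, hv, hv,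
    smul_smul, sub_smul]

theorem IsGL.lower_mul_coroot {A : Fin (r + 1) → Fin (r + 1) → Module.End ℂ V} (hA : IsGL p A)
    (a i : Fin r) : A i.succ i.castSucc * coroot p A a = coroot p A a * A i.succ i.castSucc +
      (sgn (p a.castSucc) * form p (simpleRoot a) (simpleRoot i)) • A i.succ i.castSucc := by
  rw [sgn_mul_form_simpleRoot, coroot, sub_mul, smul_mul_assoc, mul_sub, mul_smul_comm,
    hA.cartan_mul_lower, hA.cartan_mul_lower, sub_smul, mul_smul, smul_sub]
  abel

end Coroot

section TwoSites

variable {V₁ V₂ : Type*} [AddCommGroup V₁] [Module ℂ V₁] [AddCommGroup V₂] [Module ℂ V₂]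
  (M₁ : GLModule p V₁) (M₂ : GLModule p V₂)

theorem diag_mul_site₁_lower (a i : Fin r) :
    diag M₁ M₂ a.castSucc a.succ * site₁ M₁ M₂ i.succ i.castSucc =
      sgn (rootParity p a * rootParity p i) •
        (site₁ M₁ M₂ i.succ i.castSucc * diag M₁ M₂ a.castSucc a.succ) +
      if a = i then coroot p (site₁ M₁ M₂) a else 0 := by
  rw [diag, add_mul, (isGL_site₁ M₁ M₂).raise_mul_lower, site₂_mul_site₁,
    mul_add (site₁ M₁ M₂ _ _), smul_add,
    coroot, add_comm (p i.succ)]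
  simp only [rootParity]
  abel

theorem diag_mul_site₂_lower (a i : Fin r) :
    diag M₁ M₂ a.castSucc a.succ * site₂ M₁ M₂ i.succ i.castSucc =
      sgn (rootParity p a * rootParity p i) •
        (site₂ M₁ M₂ i.succ i.castSucc * diag M₁ M₂ a.castSucc a.succ) +
      if a = i then coroot p (site₂ M₁ M₂) a else 0 := by
  rw [diag, add_mul, (isGL_site₂ M₁ M₂).raise_mul_lower, site₁_mul_site₂,
    mul_add (site₂ M₁ M₂ _ _), smul_add,
    coroot, add_comm (p i.succ)]
  simp only [rootParity]
  abel

theorem diag_self_mul_site₁_lower (a : Fin (r + 1)) (i : Fin r) :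
    diag M₁ M₂ a a * site₁ M₁ M₂ i.succ i.castSucc =
      site₁ M₁ M₂ i.succ i.castSucc * diag M₁ M₂ a a -
        simpleRoot i a • site₁ M₁ M₂ i.succ i.castSucc := by
  rw [diag, add_mul, mul_add, (isGL_site₁ M₁ M₂).cartan_mul_lower, site₂_mul_site₁,
    add_self_eq_zero', zero_mul, sgn_zero, one_smul]
  abel

theorem diag_self_mul_site₂_lower (a : Fin (r + 1)) (i : Fin r) :
    diag M₁ M₂ a a * site₂ M₁ M₂ i.succ i.castSucc =
      site₂ M₁ M₂ i.succ i.castSucc * diag M₁ M₂ a a -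
        simpleRoot i a • site₂ M₁ M₂ i.succ i.castSucc := by
  rw [diag, add_mul, mul_add, (isGL_site₂ M₁ M₂).cartan_mul_lower, site₁_mul_site₂,
    add_self_eq_zero', zero_mul, sgn_zero, one_smul]
  abel

variable {L : ℕ} {c : Fin L → Fin r} {t : Fin L → ℂ} {z₁ z₂ : ℂ} {u : V₁ ⊗[ℂ] V₂}
  {lam₁ lam₂ : Fin (r + 1) → ℂ}

theorem weight_outerSum (h₁ : ∀ a, site₁ M₁ M₂ a a u = lam₁ a • u)
    (h₂ : ∀ a, site₂ M₁ M₂ a a u = lam₂ a • u) (a : Fin (r + 1)) (S : Finset (Fin L)) (x y : ℂ) :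
    diag M₁ M₂ a a (outerSum M₁ M₂ z₁ z₂ c t u S x y) =
      (lam₁ a + lam₂ a - ∑ i ∈ S, simpleRoot (c i) a) • outerSum M₁ M₂ z₁ z₂ c t u S x y := by
  refine weight_wordSum (d := fun i => simpleRoot (c i) a) (fun S => ?_) (fun i w => ?_) S x y
  · refine weight_wordSum (d := fun i => simpleRoot (c i) a) (fun S => ?_) (fun i w => ?_) S 1 0
    · split_ifs with hS
      · subst hS
        rw [diag, LinearMap.add_apply, h₁, h₂, ← add_smul, Finset.sum_empty, sub_zero]
      · rw [map_zero, smul_zero]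
    · exact congrArg (fun f : Module.End ℂ _ => f w) (diag_self_mul_site₂_lower M₁ M₂ a (c i))
  · exact congrArg (fun f : Module.End ℂ _ => f w) (diag_self_mul_site₁_lower M₁ M₂ a (c i))

theorem site₁_self_innerSum (h₁ : ∀ a, site₁ M₁ M₂ a a u = lam₁ a • u) (b : Fin (r + 1))
    (S : Finset (Fin L)) : site₁ M₁ M₂ b b (innerSum M₁ M₂ z₂ c t u S) =
      lam₁ b • innerSum M₁ M₂ z₂ c t u S := by
  have := weight_wordSum (π := fun i => rootParity p (c i)) (t := t) (z := z₂)
    (F := fun i => site₂ M₁ M₂ (c i).succ (c i).castSucc)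
    (B := fun S => if S = ∅ then u else 0) (D := site₁ M₁ M₂ b b) (d := 0) (κ := lam₁ b)
    (fun S => ?_) (fun i w => ?_) S 1 0
  · simpa [innerSum] using this
  · split_ifs <;> simp [h₁]
  · have e := congrArg (fun f : Module.End ℂ _ => f w)
      (site₁_mul_site₂ M₁ M₂ b b (c i).succ (c i).castSucc)
    rw [add_self_eq_zero', zero_mul, sgn_zero, one_smul] at e
    simpa using e

theorem raise_outerSum (ht : IsRegular z₁ z₂ t) (h₁ : ∀ a, site₁ M₁ M₂ a a u = lam₁ a • u)
    (h₂ : ∀ a, site₂ M₁ M₂ a a u = lam₂ a • u) {a : Fin r}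
    (hu : diag M₁ M₂ a.castSucc a.succ u = 0) :
    diag M₁ M₂ a.castSucc a.succ (outerSum M₁ M₂ z₁ z₂ c t u Finset.univ 1 0) =
      ∑ i, ((if a = c i then 1 else 0) * pickSign (fun i => rootParity p (c i)) i Finset.univ *
        sgn (p a.castSucc) * (form p (simpleRoot a) lam₁ / (t i - z₁) +
          form p (simpleRoot a) lam₂ / (t i - z₂) -
          ∑ j ∈ Finset.univ.erase i, form p (simpleRoot a) (simpleRoot (c j)) / (t i - t j))) •
        outerSum M₁ M₂ z₁ z₂ c t u (Finset.univ.erase i) 1 0 := by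
  set χ : Fin L → ℂ := fun i => if a = c i then 1 else 0 with hχ
  set A : Fin L → ℂ := fun j => sgn (p a.castSucc) * form p (simpleRoot a) (simpleRoot (c j))
    with hA
  set η₁ := sgn (p a.castSucc) * form p (simpleRoot a) lam₁ with hη₁
  set η₂ := sgn (p a.castSucc) * form p (simpleRoot a) lam₂ with hη₂
  have hχπ : ∀ i, χ i ≠ 0 → rootParity p (c i) = rootParity p a := by
    intro i hi
    by_cases h : a = c i
    · rw [h]
    · simp [hχ, h] at hi
  have ite_smul : ∀ (i : Fin L) (f : Module.End ℂ (V₁ ⊗[ℂ] V₂)) (w : V₁ ⊗[ℂ] V₂),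
      (if a = c i then f else 0) w = χ i • f w := by
    intro i f w
    simp only [hχ]
    split_ifs <;> simp
  have inner : ∀ S, diag M₁ M₂ a.castSucc a.succ (innerSum M₁ M₂ z₂ c t u S) =
      ∑ i ∈ S, (χ i * pickSign (fun i => rootParity p (c i)) i S *
        (η₂ / (t i - z₂) - ∑ j ∈ S.erase i, A j / (t i - t j))) •
        innerSum M₁ M₂ z₂ c t u (S.erase i) := by
    intro S
    have := raise_wordSum (E := diag M₁ M₂ a.castSucc a.succ)
      (H := coroot p (site₂ M₁ M₂) a) (ε := rootParity p a) (χ := χ) (A := A) (θ := 0) (η := η₂)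
      (π := fun i => rootParity p (c i)) (t := t) (z := z₂)
      (F := fun i => site₂ M₁ M₂ (c i).succ (c i).castSucc)
      (B := fun S => if S = ∅ then u else 0)
      ht.1 (fun i => (ht.2 i).2) hχπ ?_ ?_ ?_ ?_ S 1 0 (by simp) (by simp)
    · rw [innerSum, this]
      refine Finset.sum_congr rfl fun i _ => ?_
      rw [zero_div, zero_smul, add_zero, Pi.zero_apply, zero_add, smul_smul]
      rfl
    · intro S
      rcases S.eq_empty_or_nonempty with rfl | hS
      · simp [hu]
      · rw [if_neg hS.ne_empty, map_zero]
        refine (Finset.sum_eq_zero fun i hi => ?_).symm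
        -- A word without letters remains only if `S = {i}`, and then the coefficient is empty.
        by_cases h : S.erase i = ∅
        · simp [h]
        · simp [h]
    · intro S
      split_ifs
      · exact coroot_apply_of_weight h₂ a
      · simp
    · intro i w
      exact congrArg (fun f : Module.End ℂ _ => f w)
        ((isGL_site₂ M₁ M₂).lower_mul_coroot a (c i))
    · intro i w
      have e := congrArg (fun f : Module.End ℂ _ => f w) (diag_mul_site₂_lower M₁ M₂ a (c i))
      simp only [Module.End.mul_apply, LinearMap.add_apply, LinearMap.smul_apply, ite_smul] at e
      exact e
  have := raise_wordSum (E := diag M₁ M₂ a.castSucc a.succ)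
    (H := coroot p (site₁ M₁ M₂) a) (ε := rootParity p a) (χ := χ) (A := A)
    (θ := fun i => η₂ / (t i - z₂)) (η := η₁)
    (π := fun i => rootParity p (c i)) (t := t) (z := z₁)
    (F := fun i => site₁ M₁ M₂ (c i).succ (c i).castSucc) (B := innerSum M₁ M₂ z₂ c t u)
    ht.1 (fun i => (ht.2 i).1) hχπ inner ?_ ?_ ?_ Finset.univ 1 0 (by simp) (by simp)
  · rw [outerSum, this]
    refine Finset.sum_congr rfl fun i _ => ?_
    rw [zero_div, zero_smul, add_zero, smul_smul]
    congr 1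
    have e : ∑ j ∈ Finset.univ.erase i, A j / (t i - t j) = sgn (p a.castSucc) *
        ∑ j ∈ Finset.univ.erase i,
          form p (simpleRoot a) (simpleRoot (c j)) / (t i - t j) := by
      rw [Finset.mul_sum]
      exact Finset.sum_congr rfl fun j _ => mul_div_assoc _ _ _
    rw [e, hη₁, hη₂]
    ring
  · intro S
    exact coroot_apply_of_weight (fun b => site₁_self_innerSum M₁ M₂ h₁ b S) a
  · intro i w
    exact congrArg (fun f : Module.End ℂ _ => f w)
      ((isGL_site₁ M₁ M₂).lower_mul_coroot a (c i))
  · intro i w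
    have e := congrArg (fun f : Module.End ℂ _ => f w) (diag_mul_site₁_lower M₁ M₂ a (c i))
    simp only [Module.End.mul_apply, LinearMap.add_apply, LinearMap.smul_apply, ite_smul] at e
    exact e

/-- The weight function of a regular solution of the Bethe equations is killed by the raising
operators. -/
theorem raise_outerSum_eq_zero (hB : IsBetheSolution p lam₁ lam₂ z₁ z₂ c t)
    (ht : IsRegular z₁ z₂ t) (h₁ : ∀ a, site₁ M₁ M₂ a a u = lam₁ a • u)
    (h₂ : ∀ a, site₂ M₁ M₂ a a u = lam₂ a • u)
    (hu : ∀ a : Fin r, diag M₁ M₂ a.castSucc a.succ u = 0) {a b : Fin (r + 1)} (hab : a < b) :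
    diag M₁ M₂ a b (outerSum M₁ M₂ z₁ z₂ c t u Finset.univ 1 0) = 0 := by
  refine (isGL_diag M₁ M₂).raising_of_simple (fun a => ?_) hab
  rw [raise_outerSum M₁ M₂ ht h₁ h₂ (hu a)]
  refine Finset.sum_eq_zero fun i _ => ?_
  by_cases h : a = c i
  · have e := hB.equation i
    rw [← h] at e
    rw [show form p (simpleRoot a) lam₁ / (t i - z₁) + form p (simpleRoot a) lam₂ / (t i - z₂) -
      ∑ j ∈ Finset.univ.erase i, form p (simpleRoot a) (simpleRoot (c j)) / (t i - t j) = 0 by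
        linear_combination -e, mul_zero, zero_smul]
  · rw [if_neg h, zero_mul, zero_mul, zero_mul, zero_smul]

end TwoSites

end

/-! ### The Casimir operator of the two factors -/

section

variable {r : ℕ} {p : Fin (r + 1) → ZMod 2} {V : Type*} [AddCommGroup V] [Module ℂ V]

/-- The component `u_a` of a vector `∑ e_a ⊗ u_a`. -/
def comp (a : Fin (r + 1)) : (Fin (r + 1) → ℂ) ⊗[ℂ] V →ₗ[ℂ] V :=
  (TensorProduct.lid ℂ V).toLinearMap ∘ₗ
    TensorProduct.map (LinearMap.proj (φ := fun _ : Fin (r + 1) => ℂ) a) LinearMap.id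

theorem comp_tmul (a : Fin (r + 1)) (x : Fin (r + 1) → ℂ) (y : V) :
    comp a (x ⊗ₜ[ℂ] y) = x a • y := by
  simp [comp]

theorem sum_single_tmul_comp (w : (Fin (r + 1) → ℂ) ⊗[ℂ] V) :
    ∑ a, (Pi.single a 1 : Fin (r + 1) → ℂ) ⊗ₜ[ℂ] comp a w = w := by
  induction w using TensorProduct.induction_on with
  | zero => simp
  | tmul x y =>
    simp only [comp_tmul, ← TensorProduct.smul_tmul, ← TensorProduct.sum_tmul]
    congr 1
    ext b
    simp [Finset.sum_apply, Pi.single_apply]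
  | add x y hx hy =>
    simp only [map_add, TensorProduct.tmul_add, Finset.sum_add_distrib, hx, hy]

theorem comp_ext {w w' : (Fin (r + 1) → ℂ) ⊗[ℂ] V} (h : ∀ a, comp a w = comp a w') : w = w' := by
  rw [← sum_single_tmul_comp w, ← sum_single_tmul_comp w']
  simp only [h]

theorem comp_site₁ (M : GLModule p V) (a c d : Fin (r + 1)) (w : (Fin (r + 1) → ℂ) ⊗[ℂ] V) :
    comp a (site₁ (defining p) M c d w) = if a = c then comp d w else 0 := by
  induction w using TensorProduct.induction_on with
  | zero => simp
  | tmul x y =>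
    by_cases h : a = c <;> simp [site₁, defining, comp_tmul, h]
  | add x y hx hy =>
    simp only [map_add, hx, hy]
    split_ifs <;> simp

theorem twist_defining (x : ZMod 2) (v : Fin (r + 1) → ℂ) (a : Fin (r + 1)) :
    (defining p).twist x v a = sgn (x * p a) * v a := by
  have h2 : ∀ x : ZMod 2, x = 0 ∨ x = 1 := by decide
  rcases h2 x with rfl | rfl
  · simp [GLModule.twist, sgn_zero]
  · simp [GLModule.twist, defining]

theorem comp_site₂ (M : GLModule p V) (a c d : Fin (r + 1)) (w : (Fin (r + 1) → ℂ) ⊗[ℂ] V) :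
    comp a (site₂ (defining p) M c d w) = sgn ((p c + p d) * p a) • M.act c d (comp a w) := by
  induction w using TensorProduct.induction_on with
  | zero => simp
  | tmul x y =>
    rw [site₂_eq, TensorProduct.map_tmul, comp_tmul, comp_tmul, twist_defining, map_smul,
      smul_smul]
  | add x y hx hy => simp only [map_add, hx, hy, smul_add]

theorem comp_diag (M : GLModule p V) (a c d : Fin (r + 1)) (w : (Fin (r + 1) → ℂ) ⊗[ℂ] V) :
    comp a (diag (defining p) M c d w) = (if a = c then comp d w else 0) +
      sgn ((p c + p d) * p a) • M.act c d (comp a w) := by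
  rw [diag, LinearMap.add_apply, map_add, comp_site₁, comp_site₂]

/-- The Casimir operator `∑ (-1)^{|b|} E_{ab} ⊗ E_{ba}` of the two factors. -/
def casimir (M : GLModule p V) : Module.End ℂ ((Fin (r + 1) → ℂ) ⊗[ℂ] V) :=
  ∑ a, ∑ b, sgn (p b) • (site₁ (defining p) M a b * site₂ (defining p) M b a)

theorem comp_casimir (M : GLModule p V) (a : Fin (r + 1)) (w : (Fin (r + 1) → ℂ) ⊗[ℂ] V) :
    comp a (casimir M w) = ∑ d, sgn (p a * p d) • M.act d a (comp d w) := by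
  simp only [casimir, LinearMap.sum_apply, LinearMap.smul_apply, Module.End.mul_apply, map_sum,
    map_smul, comp_site₁]
  rw [Finset.sum_comm]
  refine Finset.sum_congr rfl fun d _ => ?_
  rw [Finset.sum_eq_single a (fun b _ hb => by rw [if_neg (Ne.symm hb), smul_zero]) (by simp),
    if_pos rfl, comp_site₂, smul_smul, add_mul, mul_self_zmod2, sgn_add, ← mul_assoc,
    sgn_mul_self, one_mul]

/-- The Casimir operator commutes with `gl(m|n)`. -/
theorem casimir_diag (M : GLModule p V) (c d : Fin (r + 1)) (w : (Fin (r + 1) → ℂ) ⊗[ℂ] V) :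
    casimir M (diag (defining p) M c d w) = diag (defining p) M c d (casimir M w) := by
  refine comp_ext fun a => ?_
  rw [comp_casimir, comp_diag, comp_casimir, comp_casimir, map_sum, Finset.smul_sum]
  have e : ∀ e, sgn ((p c + p d) * p a) • M.act c d (sgn (p a * p e) • M.act e a (comp e w)) =
      sgn (p a * p e) • sgn ((p c + p d) * p e) • M.act e a (M.act c d (comp e w)) +
      (if e = d then sgn (p c * p a) • M.act c a (comp d w) else 0) -
      (if a = c then sgn (p d * p e) • M.act e d (comp e w) else 0) := by
    intro e
    have h := congrArg (fun f : Module.End ℂ V => f (comp e w)) (M.isGL c d e a)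
    simp only [Module.End.mul_apply, LinearMap.sub_apply, LinearMap.add_apply,
      LinearMap.smul_apply] at h
    have h2 : ∀ x : ZMod 2, x = 0 ∨ x = 1 := by decide
    have h11 : (1 : ZMod 2) + 1 = 0 := rfl
    have hs1 : sgn 1 = -1 := by simp [sgn]
    rw [map_smul, h]
    by_cases h1 : e = d <;> by_cases h3 : a = c
    · subst h1 h3
      rcases h2 (p a) with k1 | k1 <;> rcases h2 (p e) with k2 | k2 <;>
        simp only [k1, k2, if_true, mul_one, mul_zero, add_zero, zero_add, h11, hs1, sgn_zero] <;> module
    · subst h1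
      rcases h2 (p a) with k1 | k1 <;> rcases h2 (p e) with k2 | k2 <;>
        rcases h2 (p c) with k3 | k3 <;>
        simp only [k1, k2, k3, if_true, if_neg h3, if_neg (Ne.symm h3), LinearMap.zero_apply,
          mul_one, mul_zero, add_zero, zero_add, h11, hs1, sgn_zero] <;> module
    · subst h3
      rcases h2 (p a) with k1 | k1 <;> rcases h2 (p e) with k2 | k2 <;>
        rcases h2 (p d) with k3 | k3 <;>
        simp only [k1, k2, k3, if_true, if_neg h1, if_neg (Ne.symm h1), LinearMap.zero_apply,
          mul_one, mul_zero, add_zero, zero_add, h11, hs1, sgn_zero] <;> module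
    · rcases h2 (p a) with k1 | k1 <;> rcases h2 (p e) with k2 | k2 <;>
        rcases h2 (p d) with k3 | k3 <;> rcases h2 (p c) with k4 | k4 <;>
        simp only [k1, k2, k3, k4, if_neg h1, if_neg (Ne.symm h1), if_neg h3, if_neg (Ne.symm h3),
          LinearMap.zero_apply,
          mul_one, mul_zero, add_zero, zero_add, h11, hs1, sgn_zero] <;> module
  rw [Finset.sum_congr rfl fun x _ => e x]
  simp only [comp_diag, map_add, smul_add, Finset.sum_add_distrib, Finset.sum_sub_distrib,
    map_smul]
  have e1 : ∑ x, sgn (p a * p x) • M.act x a (if x = c then comp d w else 0) =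
      ∑ x, if x = d then sgn (p c * p a) • M.act c a (comp d w) else 0 := by
    rw [Finset.sum_ite_eq' Finset.univ d, if_pos (Finset.mem_univ d),
      Finset.sum_eq_single c (fun b _ hb => by rw [if_neg hb, map_zero, smul_zero]) (by simp),
      if_pos rfl, mul_comm]
  rw [e1]
  by_cases h : a = c
  · simp only [if_pos h]; abel
  · simp only [if_neg h, Finset.sum_const_zero]; abel

/-- The eigenvalue `(lam, ε_b) - ∑_{d < b} (ε_d, ε_d)` of the Casimir operator on the vectors of
weight `lam + ε_b` that are killed by the raising operators. If `lam` belongs to a hook diagram and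
`lam + ε_b` arises from it by adding a box, it is the content of that box. -/
def content (p : Fin (r + 1) → ZMod 2) (lam : Fin (r + 1) → ℂ) (b : Fin (r + 1)) : ℂ :=
  sgn (p b) * lam b - ∑ d ∈ Finset.univ.filter (· < b), sgn (p d)

theorem eps_injective : Function.Injective (eps (r := r)) := by
  intro a b h
  by_contra hab
  have := congrFun h a
  simp [eps, hab] at this

/-- The last component of a weight vector that is killed by the raising operators is a highest
weight vector. -/
theorem exists_top_component {M : GLModule p V} {lam : Fin (r + 1) → ℂ} {v : V}
    (hM : IsIrreducibleHighestWeight M lam v) {w : (Fin (r + 1) → ℂ) ⊗[ℂ] V} (hw0 : w ≠ 0)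
    {κ : Fin (r + 1) → ℂ} (hκ : ∀ a, diag (defining p) M a a w = κ a • w)
    (hE : ∀ a b, a < b → diag (defining p) M a b w = 0) :
    ∃ b, κ = lam + eps b ∧ comp b w ≠ 0 ∧ (∀ a, b < a → comp a w = 0) := by
  classical
  obtain ⟨b, hb, hmax⟩ : ∃ b, comp b w ≠ 0 ∧ ∀ a, b < a → comp a w = 0 := by
    have hne : (Finset.univ.filter fun a => comp a w ≠ 0).Nonempty := by
      by_contra h
      rw [Finset.not_nonempty_iff_eq_empty, Finset.filter_eq_empty_iff] at h
      exact hw0 (comp_ext fun a => by rw [map_zero]; exact not_not.mp (h (Finset.mem_univ a)))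
    obtain ⟨b, hb, hmax⟩ := Finset.exists_max_image _ id hne
    refine ⟨b, (Finset.mem_filter.mp hb).2, fun a ha => ?_⟩
    by_contra h
    exact absurd (hmax a (Finset.mem_filter.mpr ⟨Finset.mem_univ a, h⟩)) (not_le.mpr ha)
  refine ⟨b, ?_, hb, hmax⟩
  have h := hM.weight_unique hb (κ := κ - eps b) (fun a => ?_) (fun c d hcd => ?_)
  · rw [← h, sub_add_cancel]
  · have := comp_diag M b a a w
    rw [hκ, map_smul, add_self_eq_zero', zero_mul, sgn_zero, one_smul] at this
    rw [Pi.sub_apply, sub_smul, this]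
    by_cases hab : b = a
    · subst hab; simp [eps]
    · simp [eps, hab, Ne.symm hab]
  · have := comp_diag M b c d w
    rw [hE c d hcd, map_zero] at this
    have h0 : (if b = c then comp d w else 0) = 0 := by
      split_ifs with hbc
      · exact hmax d (hbc ▸ hcd)
      · rfl
    rw [h0, zero_add] at this
    exact (smul_eq_zero.mp this.symm).resolve_left (sgn_ne_zero _)

theorem comp_casimir_of_top {M : GLModule p V} {w : (Fin (r + 1) → ℂ) ⊗[ℂ] V}
    (hE : ∀ a b, a < b → diag (defining p) M a b w = 0) {b a : Fin (r + 1)} (hba : b ≤ a)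
    (htop : ∀ a, b < a → comp a w = 0) {x : ℂ} (hx : M.act b b (comp b w) = x • comp b w) :
    comp a (casimir M w) =
      (sgn (p b) * x - ∑ d ∈ Finset.univ.filter (· < b), sgn (p d)) • comp a w := by
  have below : ∀ d, d < a → sgn (p a * p d) • M.act d a (comp d w) = -(sgn (p d) • comp a w) := by
    intro d hd
    have := comp_diag M d d a w
    rw [hE d a hd, map_zero, if_pos rfl] at this
    have h : sgn ((p d + p a) * p d) • M.act d a (comp d w) = -comp a w := by
      rw [eq_neg_iff_add_eq_zero, add_comm, ← this]
    rw [add_mul, mul_self_zmod2, sgn_add] at h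
    rw [← smul_neg, ← h, smul_smul, ← mul_assoc, sgn_mul_self, one_mul]
  rw [comp_casimir]
  rcases hba.eq_or_lt with rfl | hlt
  · rw [sub_smul, Finset.sum_smul, sub_eq_add_neg, ← Finset.sum_neg_distrib,
      ← Finset.add_sum_erase _ _ (Finset.mem_univ b), hx, mul_self_zmod2, smul_smul]
    congr 1
    rw [← Finset.sum_subset (s₁ := Finset.univ.filter (· < b))]
    · exact Finset.sum_congr rfl fun d hd => below d (Finset.mem_filter.mp hd).2
    · intro d hd
      exact Finset.mem_erase.mpr ⟨ne_of_lt (Finset.mem_filter.mp hd).2, Finset.mem_univ d⟩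
    · intro d hd hd'
      have : b < d := lt_of_le_of_ne
        (not_lt.mp fun h => hd' (Finset.mem_filter.mpr ⟨Finset.mem_univ d, h⟩))
        (Ne.symm (Finset.mem_erase.mp hd).1)
      rw [htop d this, map_zero, smul_zero]
  · rw [htop a hlt, smul_zero]
    refine Finset.sum_eq_zero fun d _ => ?_
    rcases lt_or_ge d a with hd | hd
    · rw [below d hd, htop a hlt, smul_zero, neg_zero]
    · rw [htop d (hlt.trans_le hd), map_zero, smul_zero]

/-- A weight vector that is killed by the raising operators is an eigenvector of the Casimir
operator. -/
theorem casimir_eigenvector {M : GLModule p V} {lam : Fin (r + 1) → ℂ} {v : V}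
    (hM : IsIrreducibleHighestWeight M lam v) {w : (Fin (r + 1) → ℂ) ⊗[ℂ] V} (hw0 : w ≠ 0)
    {κ : Fin (r + 1) → ℂ} (hκ : ∀ a, diag (defining p) M a a w = κ a • w)
    (hE : ∀ a b, a < b → diag (defining p) M a b w = 0) :
    ∃ b, κ = lam + eps b ∧ casimir M w = content p lam b • w := by
  obtain ⟨b, hb, -, htop⟩ := exists_top_component hM hw0 hκ hE
  refine ⟨b, hb, ?_⟩
  by_contra hne
  have hx : M.act b b (comp b w) = lam b • comp b w := by
    have := comp_diag M b b b w
    rw [hκ, map_smul, add_self_eq_zero', zero_mul, sgn_zero, one_smul, if_pos rfl, hb] at this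
    rw [← sub_eq_iff_eq_add'] at this
    rw [← this]
    simp [eps, add_smul]
  -- The difference has the weight of `w`, but its last component stands before the `b`-th.
  set D := casimir M w - content p lam b • w with hD
  obtain ⟨b', hb', hcomp, -⟩ := exists_top_component hM (sub_ne_zero.mpr hne) (κ := κ)
    (fun a => by rw [map_sub, ← casimir_diag, hκ, map_smul, map_smul, hκ, smul_sub, smul_comm])
    (fun c d hcd => by
      rw [map_sub, ← casimir_diag, hE c d hcd, map_zero, map_smul, hE c d hcd, smul_zero,
        sub_zero])
  have : b = b' := eps_injective (add_left_cancel (hb.symm.trans hb'))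
  subst this
  refine hcomp ?_
  rw [map_sub, comp_casimir_of_top hE le_rfl htop hx, map_smul, content, sub_self]

theorem gaudin₁_eq_casimir (M : GLModule p V) (z₁ z₂ : ℂ) :
    gaudin₁ (defining p) M z₁ z₂ = (1 / (z₁ - z₂)) • casimir M := rfl

end

/-! ### The last component of the weight function -/

section

variable {r L : ℕ} {p : Fin (r + 1) → ZMod 2} {V : Type*} [AddCommGroup V] [Module ℂ V]

theorem site₁_self_e₁_tmul (M : GLModule p V) (v : V) (a : Fin (r + 1)) :
    site₁ (defining p) M a a (e₁ r ⊗ₜ[ℂ] v) = eps 0 a • (e₁ r ⊗ₜ[ℂ] v) := by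
  refine comp_ext fun b => ?_
  rw [comp_site₁, map_smul, comp_tmul, comp_tmul]
  by_cases hb : b = a
  · subst hb
    by_cases h0 : b = 0
    · subst h0; simp [e₁, eps]
    · simp [e₁, eps, h0]
  · by_cases h0 : b = 0
    · subst h0; simp [e₁, eps, hb, Ne.symm hb]
    · simp [e₁, hb, h0]

/-- If the variables in `S` have the colours `0, …, d - 1`, once each, then only the word
`F_{d-1} ⋯ F_0`, which takes `e_0` to `e_d`, contributes to the component of the weight function at
`e_d` (indices are counted from zero). -/
theorem comp_outerSum (M : GLModule p V) (v : V) {z₁ z₂ : ℂ} {c : Fin L → Fin r}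
    {t : Fin L → ℂ} (ht : IsRegular z₁ z₂ t) (hc : Function.Injective c) (d : ℕ) (hd : d < r + 1)
    (S : Finset (Fin L)) (hlt : ∀ i ∈ S, (c i : ℕ) < d)
    (hsurj : ∀ a < d, ∃ i ∈ S, (c i : ℕ) = a) (x y : ℂ) (hS : ∀ i ∈ S, x - y * t i ≠ 0)
    (hxz : x - y * z₁ ≠ 0) :
    ∃ k : ℂ, k ≠ 0 ∧
      comp ⟨d, hd⟩ (outerSum (defining p) M z₁ z₂ c t (e₁ r ⊗ₜ[ℂ] v) S x y) = k • v := by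
  induction d generalizing S x y with
  | zero =>
    have : S = ∅ := Finset.eq_empty_of_forall_notMem fun i hi => absurd (hlt i hi) (by simp)
    subst this
    refine ⟨1 / (x - y * z₁), one_div_ne_zero hxz, ?_⟩
    rw [outerSum, wordSum_eq, innerSum, wordSum_eq]
    simp [comp_tmul, e₁]
  | succ d ih =>
    obtain ⟨i, hi, hid⟩ := hsurj d d.lt_succ_self
    obtain ⟨k, hk, hcomp⟩ := ih (by omega) (S.erase i)
      (fun j hj => by
        obtain ⟨hji, hjS⟩ := Finset.mem_erase.mp hj
        have h1 := hlt j hjS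
        have h2 : (c j : ℕ) ≠ c i := fun h => hji (hc (Fin.ext h))
        omega)
      (fun a ha => by
        obtain ⟨j, hj, hja⟩ := hsurj a (by omega)
        refine ⟨j, Finset.mem_erase.mpr ⟨?_, hj⟩, hja⟩
        rintro rfl
        omega)
      (t i) 1
      (fun j hj => by
        rw [one_mul, sub_ne_zero]
        exact fun h => (Finset.mem_erase.mp hj).1 (ht.1 h.symm))
      (by rw [one_mul, sub_ne_zero]; exact (ht.2 i).1)
    refine ⟨pickSign (fun i => rootParity p (c i)) i S / (x - y * t i) * k,
      mul_ne_zero (div_ne_zero (pickSign_ne_zero _ _ _) (hS i hi)) hk, ?_⟩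
    have inner : comp ⟨d + 1, hd⟩ (innerSum (defining p) M z₂ c t (e₁ r ⊗ₜ[ℂ] v) S) = 0 := by
      have := congrArg (comp ⟨d + 1, hd⟩) (site₁_self_innerSum (z₂ := z₂) (c := c) (t := t)
        (defining p) M (fun a => site₁_self_e₁_tmul M v a) 0 S)
      rw [comp_site₁, if_neg (by simp [Fin.ext_iff]), map_smul, eps, Pi.single_eq_same,
        one_smul] at this
      exact this.symm
    have e := wordSum_eq (π := fun i => rootParity p (c i)) (t := t) (z := z₁)
      (F := fun i => site₁ (defining p) M (c i).succ (c i).castSucc)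
      (B := innerSum (defining p) M z₂ c t (e₁ r ⊗ₜ[ℂ] v)) S x y
    rw [outerSum, e, map_add, map_smul, inner, smul_zero, zero_add, map_sum,
      Finset.sum_eq_single i]
    · rw [map_smul, comp_site₁, if_pos (by simp [Fin.ext_iff, hid])]
      have : (c i).castSucc = ⟨d, by omega⟩ := Fin.ext hid
      rw [this]
      rw [outerSum] at hcomp
      rw [hcomp, smul_smul]
    · intro j hj hji
      rw [map_smul, comp_site₁, if_neg, smul_zero]
      intro h
      have h1 : d = (c j : ℕ) := by simpa [Fin.ext_iff] using h
      exact hji (hc (Fin.ext (by omega)))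
    · exact fun h => absurd hi h

end

/-! ### Contents of hook diagrams -/

section

variable {r : ℕ} {p : Fin (r + 1) → ZMod 2}

/-- The components of the highest weight of the polynomial module as natural numbers. -/
def hookNat (p : Fin (r + 1) → ZMod 2) (μ : YoungDiagram) (a : Fin (r + 1)) : ℕ :=
  if p a = 0 then μ.rowLen (before p 0 a) - before p 1 a
  else μ.colLen (before p 1 a) - before p 0 a

/-- The sign of a parity as an integer. -/
def sgnInt (x : ZMod 2) : ℤ := if x = 0 then 1 else -1

/-- The integer `content p (hookWeight p μ) a`. -/
def hookContent (p : Fin (r + 1) → ZMod 2) (μ : YoungDiagram) (a : Fin (r + 1)) : ℤ :=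
  sgnInt (p a) * hookNat p μ a - before p 0 a + before p 1 a

/-- The value `(α_a, λ)` as an integer. -/
def hookRoot (p : Fin (r + 1) → ZMod 2) (μ : YoungDiagram) (a : Fin r) : ℤ :=
  sgnInt (p a.castSucc) * hookNat p μ a.castSucc - sgnInt (p a.succ) * hookNat p μ a.succ

theorem before_zero (x : ZMod 2) : before p x 0 = 0 := by simp [before]

theorem before_succ (x : ZMod 2) (a : Fin r) :
    before p x a.succ = before p x a.castSucc + if p a.castSucc = x then 1 else 0 := by
  have e : ∀ b : Fin (r + 1), b < a.succ ↔ b = a.castSucc ∨ b < a.castSucc := by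
    intro b
    rw [← Fin.le_castSucc_iff, le_iff_eq_or_lt]
  have h : (Finset.univ.filter fun b => b < a.succ ∧ p b = x) =
      if p a.castSucc = x then insert a.castSucc
        (Finset.univ.filter fun b => b < a.castSucc ∧ p b = x)
      else Finset.univ.filter fun b => b < a.castSucc ∧ p b = x := by
    ext b
    split_ifs with hx <;>
      simp only [Finset.mem_filter, Finset.mem_univ, true_and, Finset.mem_insert, e]
    · constructor
      · rintro ⟨rfl | h, h'⟩ <;> tauto
      · rintro (rfl | h) <;> tauto
    · constructor
      · rintro ⟨rfl | h, h'⟩ <;> tauto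
      · tauto
  rw [before, h]
  split_ifs
  · rw [Finset.card_insert_of_notMem (by simp)]; rfl
  · rfl

theorem before_mono (x : ZMod 2) {a b : Fin (r + 1)} (h : a ≤ b) : before p x a ≤ before p x b :=
  Finset.card_le_card fun c hc => by
    simp only [Finset.mem_filter, Finset.mem_univ, true_and] at hc ⊢
    exact ⟨hc.1.trans_le h, hc.2⟩

theorem before_lt {x : ZMod 2} {a b : Fin (r + 1)} (h : a < b) (hx : p a = x) :
    before p x a < before p x b := by
  refine Finset.card_lt_card (Finset.ssubset_iff.mpr ⟨a, by simp, fun c hc => ?_⟩)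
  simp only [Finset.mem_insert, Finset.mem_filter, Finset.mem_univ, true_and] at hc ⊢
  rcases hc with rfl | hc
  · exact ⟨h, hx⟩
  · exact ⟨hc.1.trans h, hc.2⟩

theorem exists_before_eq {x : ZMod 2} {b : Fin (r + 1)} {k : ℕ} (h : k < before p x b) :
    ∃ a : Fin r, a.castSucc < b ∧ p a.castSucc = x ∧ before p x a.castSucc = k := by
  induction b using Fin.induction with
  | zero => rw [before_zero] at h; omega
  | succ b ih =>
    rw [before_succ] at h
    by_cases hk : k < before p x b.castSucc
    · obtain ⟨a, h1, h2⟩ := ih hk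
      exact ⟨a, h1.trans b.castSucc_lt_succ, h2⟩
    · split_ifs at h with hx
      · exact ⟨b, b.castSucc_lt_succ, hx, by omega⟩
      · omega

theorem parity_cases (x : ZMod 2) : x = 0 ∨ x = 1 := by revert x; decide

/-- Once the diagram is exhausted, all further components of the highest weight vanish. -/
theorem hookNat_eq_zero_of_lt {μ : YoungDiagram} {a b : Fin (r + 1)} (hab : a < b)
    (ha : hookNat p μ a = 0) : hookNat p μ b = 0 := by
  have key : ∀ i j, j < μ.rowLen i ↔ i < μ.colLen j := fun i j => by
    rw [← YoungDiagram.mem_iff_lt_rowLen, YoungDiagram.mem_iff_lt_colLen]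
  have m0 := before_mono (p := p) 0 hab.le
  have m1 := before_mono (p := p) 1 hab.le
  unfold hookNat at *
  rcases parity_cases (p a) with h | h <;> rcases parity_cases (p b) with h' | h' <;>
    simp only [h, h', if_true, one_ne_zero, if_false] at ha ⊢
  · have := μ.rowLen_anti _ _ m0
    omega
  · have h0 := before_lt hab h
    have := μ.colLen_anti _ _ m1
    have := key (before p 0 a) (before p 1 a)
    omega
  · have h0 := before_lt hab h
    have := μ.rowLen_anti _ _ m0
    have := key (before p 0 a) (before p 1 a)
    omega
  · have := μ.colLen_anti _ _ m1
    omega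

/-- Let `b = s + 1`. If the Bethe equations for the colours up to `s` have a solution, then the
contents at `a < b` stay away from the one at `b`; here `e_b` is even. Of the equations only the two
consequences `hs` and `hroot` are needed: they exclude that the box at `b` cannot be added to the
diagram. -/
theorem two_le_content_sub_of_even {μ : YoungDiagram} {s : Fin r} (hb : p s.succ = 0)
    (hs : hookRoot p μ s ≠ 0)
    (hroot : ∀ a < s, sgnInt (p a.castSucc) *
      (hookContent p μ a.castSucc - hookContent p μ s.succ) = 1 → hookRoot p μ a = 0)
    {a : Fin r} (ha : a ≤ s) :
    2 ≤ sgnInt (p a.castSucc) * (hookContent p μ a.castSucc - hookContent p μ s.succ) := by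
  have key : ∀ i j, j < μ.rowLen i ↔ i < μ.colLen j := fun i j => by
    rw [← YoungDiagram.mem_iff_lt_rowLen, YoungDiagram.mem_iff_lt_colLen]
  have pos : ∀ a : Fin r, a ≤ s → 0 < hookNat p μ a.castSucc := by
    intro a ha
    by_contra h
    have h := Nat.eq_zero_of_not_pos h
    have h1 : hookNat p μ s.succ = 0 :=
      hookNat_eq_zero_of_lt (a.castSucc_lt_succ.trans_le (Fin.succ_le_succ_iff.mpr ha)) h
    have h2 : hookNat p μ s.castSucc = 0 := by
      rcases ha.eq_or_lt with rfl | hlt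
      · exact h
      · exact hookNat_eq_zero_of_lt (Fin.castSucc_lt_castSucc_iff.mpr hlt) h
    exact hs (by simp [hookRoot, h1, h2])
  -- The basis vector after `e_a` has the other parity if `e_a` is the last one of its parity.
  have next : ∀ a < s, ∀ x, p a.castSucc = x →
      before p x s.succ = before p x a.castSucc + 1 → p a.succ ≠ x := by
    intro a has x hx hbef h
    have h1 : a.succ < s.succ := Fin.succ_lt_succ_iff.mpr has
    have h2 := before_lt h1 h
    rw [before_succ, if_pos hx] at h2
    omega
  set R := before p 0 s.succ with hR
  set Q := before p 1 s.succ with hQ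
  have hRs := before_succ (p := p) 0 s
  have hQs := before_succ (p := p) 1 s
  have hcb : hookContent p μ s.succ = hookNat p μ s.succ - R + Q := by
    simp [hookContent, sgnInt, hb, hR, hQ]
  have hbnat : hookNat p μ s.succ = μ.rowLen R - Q := by simp [hookNat, hb, hR, hQ]
  -- The row of `e_b` is not shorter than the number of columns removed before.
  have untrunc : Q ≤ μ.rowLen R := by
    by_contra hlt
    rcases parity_cases (p s.castSucc) with h | h
    · obtain ⟨a, has, hpa, hbefore⟩ := exists_before_eq (p := p) (x := 1) (b := s.succ)
        (k := Q - 1) (by omega)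
      have has' : a < s := by
        refine lt_of_le_of_ne (Fin.succ_le_succ_iff.mp (Fin.castSucc_lt_iff_succ_le.mp has)) ?_
        rintro rfl
        rw [h] at hpa
        exact zero_ne_one hpa
      have hposa := pos a has'.le
      have hposs := pos s le_rfl
      have hnext := (parity_cases _).resolve_right (next a has' 1 hpa (by omega))
      have m0 := before_mono (p := p) 0 has.le
      have k1 := key R (Q - 1)
      have k2 := key (R - 1) (Q - 1)
      simp only [h, if_true] at hRs
      simp only [h, zero_ne_one, if_false] at hQs
      have hnat : hookNat p μ a.castSucc = μ.colLen (Q - 1) - before p 0 a.castSucc := by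
        simp [hookNat, hpa, hbefore]
      have hnat' : hookNat p μ s.castSucc =
          μ.rowLen (before p 0 s.castSucc) - before p 1 s.castSucc := by
        simp [hookNat, h]
      have hR1 : R - 1 = before p 0 s.castSucc := by omega
      rw [hR1] at k2
      have hca : hookContent p μ a.castSucc =
          -hookNat p μ a.castSucc - before p 0 a.castSucc + (Q - 1 : ℕ) := by
        simp [hookContent, sgnInt, hpa, hbefore]
      have hz := hroot a has' (by
        rw [hca, hcb, hpa]
        simp only [sgnInt, one_ne_zero, if_false]
        omega)
      rw [hookRoot, hpa, hnext] at hz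
      simp only [sgnInt, one_ne_zero, if_false, if_true] at hz
      omega
    · have hposs := pos s le_rfl
      simp only [h, one_ne_zero, if_false] at hRs
      simp only [h, if_true] at hQs
      have hnat' : hookNat p μ s.castSucc =
          μ.colLen (before p 1 s.castSucc) - before p 0 s.castSucc := by
        simp [hookNat, h]
      have k1 := key R (before p 1 s.castSucc)
      omega
  have hposa := pos a ha
  have halt : a.castSucc < s.succ := a.castSucc_lt_succ.trans_le (Fin.succ_le_succ_iff.mpr ha)
  have m0 := before_mono (p := p) 0 halt.le
  have m1 := before_mono (p := p) 1 halt.le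
  rcases parity_cases (p a.castSucc) with hpa | hpa
  · have hlt : before p 0 a.castSucc < R := before_lt halt hpa
    have hca : hookContent p μ a.castSucc =
        hookNat p μ a.castSucc - before p 0 a.castSucc + before p 1 a.castSucc := by
      simp [hookContent, sgnInt, hpa]
    have hnat : hookNat p μ a.castSucc =
        μ.rowLen (before p 0 a.castSucc) - before p 1 a.castSucc := by
      simp [hookNat, hpa]
    have anti := μ.rowLen_anti _ _ hlt.le
    by_contra hcon
    rw [hca, hcb, hpa] at hcon
    simp only [sgnInt, if_true] at hcon
    -- The rows of `e_a` and `e_b` are adjacent and have the same length.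
    have hadj : R = before p 0 a.castSucc + 1 := by omega
    have hrow : μ.rowLen R = μ.rowLen (before p 0 a.castSucc) := by omega
    rcases ha.eq_or_lt with rfl | has
    · simp only [hpa, zero_ne_one, if_false] at hQs
      refine hs ?_
      rw [hookRoot, hpa, hb]
      simp only [sgnInt, if_true]
      omega
    · have hnext := (parity_cases _).resolve_left (next a has 0 hpa (by omega))
      have hz := hroot a has (by
        rw [hca, hcb, hpa]
        simp only [sgnInt, if_true]
        omega)
      rw [hookRoot, hpa, hnext] at hz
      simp only [sgnInt, one_ne_zero, if_false, if_true] at hz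
      omega
  · have hlt := before_lt halt hpa
    have hca : hookContent p μ a.castSucc =
        -hookNat p μ a.castSucc - before p 0 a.castSucc + before p 1 a.castSucc := by
      simp [hookContent, sgnInt, hpa]
    have hnat : hookNat p μ a.castSucc =
        μ.colLen (before p 1 a.castSucc) - before p 0 a.castSucc := by
      simp [hookNat, hpa]
    have k1 := key R (before p 1 a.castSucc)
    rw [hca, hcb, hpa]
    simp only [sgnInt, one_ne_zero, if_false]
    omega

theorem before_add_one (x : ZMod 2) (a : Fin (r + 1)) :
    before (fun b => p b + 1) x a = before p (x + 1) a := by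
  have : ∀ y x : ZMod 2, y + 1 = x ↔ y = x + 1 := by decide
  simp only [before, this]

theorem hookNat_transpose (μ : YoungDiagram) (a : Fin (r + 1)) :
    hookNat (fun b => p b + 1) μ.transpose a = hookNat p μ a := by
  have h11 : (1 : ZMod 2) + 1 = 0 := rfl
  rcases parity_cases (p a) with h | h <;>
    simp [hookNat, before_add_one, h, h11]

theorem sgnInt_add_one (x : ZMod 2) : sgnInt (x + 1) = -sgnInt x := by
  revert x; decide

theorem hookContent_transpose (μ : YoungDiagram) (a : Fin (r + 1)) :
    hookContent (fun b => p b + 1) μ.transpose a = -hookContent p μ a := by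
  have h11 : (1 : ZMod 2) + 1 = 0 := rfl
  simp only [hookContent, hookNat_transpose, before_add_one, sgnInt_add_one, h11, zero_add]
  ring

theorem hookRoot_transpose (μ : YoungDiagram) (a : Fin r) :
    hookRoot (fun b => p b + 1) μ.transpose a = -hookRoot p μ a := by
  simp only [hookRoot, hookNat_transpose, sgnInt_add_one]
  ring

/-- The statement of `two_le_content_sub_of_even` without restriction on the parity of `e_b`. -/
theorem two_le_content_sub {μ : YoungDiagram} {s : Fin r}
    (hs : hookRoot p μ s ≠ 0)
    (hroot : ∀ a < s, sgnInt (p a.castSucc) *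
      (hookContent p μ a.castSucc - hookContent p μ s.succ) = 1 → hookRoot p μ a = 0)
    {a : Fin r} (ha : a ≤ s) :
    2 ≤ sgnInt (p a.castSucc) * (hookContent p μ a.castSucc - hookContent p μ s.succ) := by
  rcases parity_cases (p s.succ) with hb | hb
  · exact two_le_content_sub_of_even hb hs hroot ha
  · -- The transposed diagram and the opposite parities.
    have e : ∀ a : Fin r, sgnInt (p a.castSucc + 1) *
        (hookContent (fun b => p b + 1) μ.transpose a.castSucc -
          hookContent (fun b => p b + 1) μ.transpose s.succ) =
        sgnInt (p a.castSucc) * (hookContent p μ a.castSucc - hookContent p μ s.succ) := by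
      intro a
      rw [hookContent_transpose, hookContent_transpose, sgnInt_add_one]
      ring
    rw [← e]
    refine two_le_content_sub_of_even (p := fun b => p b + 1) ?_ ?_ (fun a ha h => ?_) ha
    · rw [hb]; rfl
    · rw [hookRoot_transpose, neg_ne_zero]; exact hs
    · rw [e] at h
      rw [hookRoot_transpose, hroot a ha h, neg_zero]

end

/-! ### The Bethe equations for distinct colours -/

section

/-- The Bethe equations for one variable of each of the colours `0, …, s - 1` in the coordinate
`x (a + 1) = t_a - z₂`, where `x 0 = z₁ - z₂`, are solved by downward recursion for the quantities
`x (a + 1) / (x (a + 1) - x a)`. -/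
theorem chain_recursion {s : ℕ} {σ A κ x : ℕ → ℂ} (hκ : ∀ a < s, κ (a + 1) = κ a - A a - σ a)
    (hx : ∀ a < s, A a ≠ 0 → x (a + 1) ≠ 0) (hne : ∀ a < s, x (a + 1) ≠ x a)
    (heq : ∀ a < s, A a / x (a + 1) + σ a / (x (a + 1) - x a) +
      (if a + 1 < s then σ (a + 1) / (x (a + 1) - x (a + 2)) else 0) = 0) (a : ℕ) (ha : a < s) :
    σ a * x (a + 1) / (x (a + 1) - x a) = κ s - κ a + σ a := by
  have clear : ∀ a < s, A a / x (a + 1) * x (a + 1) = A a := by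
    intro a ha
    by_cases h : A a = 0
    · simp [h]
    · rw [div_mul_cancel₀ _ (hx a ha h)]
  have key : ∀ k a, a + k + 1 = s →
      σ a * x (a + 1) / (x (a + 1) - x a) = κ s - κ a + σ a := by
    intro k
    induction k with
    | zero =>
      intro a ha
      have h := heq a (by omega)
      rw [if_neg (by omega)] at h
      rw [← ha, add_zero, hκ a (by omega)]
      linear_combination x (a + 1) * h - clear a (by omega)
    | succ k ih =>
      intro a ha
      have h := heq a (by omega)
      rw [if_pos (by omega)] at h
      have ih := ih (a + 1) (by omega)
      rw [hκ a (by omega)] at ih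
      have h1 : x (a + 1 + 1) - x (a + 1) ≠ 0 := sub_ne_zero.mpr (hne (a + 1) (by omega))
      have h2 : x (a + 1) - x (a + 2) ≠ 0 := by
        rw [← neg_sub]; exact neg_ne_zero.mpr h1
      have h3 : σ (a + 1) / (x (a + 1) - x (a + 2)) * x (a + 1) =
          σ (a + 1) - σ (a + 1) * x (a + 1 + 1) / (x (a + 1 + 1) - x (a + 1)) := by
        have : x (a + 1) - x (a + 2) = -(x (a + 1 + 1) - x (a + 1)) := by ring
        rw [this]
        field_simp
        ring
      linear_combination x (a + 1) * h - clear a (by omega) - h3 + ih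
  exact key (s - a - 1) a (by omega)

/-- The last coefficient of a solvable chain does not vanish. -/
theorem chain_last_ne_zero {s : ℕ} {σ A x : ℕ → ℂ} (hσ : ∀ a, σ a ≠ 0)
    (hne : ∀ a < s, x (a + 1) ≠ x a)
    (heq : ∀ a < s, A a / x (a + 1) + σ a / (x (a + 1) - x a) +
      (if a + 1 < s then σ (a + 1) / (x (a + 1) - x (a + 2)) else 0) = 0) (a : ℕ)
    (ha : a + 1 = s) : A a ≠ 0 := by
  intro h
  have := heq a (by omega)
  rw [h, zero_div, zero_add, if_neg (by omega), add_zero] at this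
  exact div_ne_zero (hσ a) (sub_ne_zero.mpr (hne a (by omega))) this

theorem chain_coefficient_eq_zero {s : ℕ} {σ A κ x : ℕ → ℂ} (hσ : ∀ a, σ a * σ a = 1)
    (hκ : ∀ a < s, κ (a + 1) = κ a - A a - σ a)
    (hx : ∀ a < s, A a ≠ 0 → x (a + 1) ≠ 0) (hne : ∀ a < s, x (a + 1) ≠ x a)
    (heq : ∀ a < s, A a / x (a + 1) + σ a / (x (a + 1) - x a) +
      (if a + 1 < s then σ (a + 1) / (x (a + 1) - x (a + 2)) else 0) = 0) (a : ℕ) (ha : a < s)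
    (h : σ a * (κ a - κ s) = 1) : A a = 0 := by
  have e := chain_recursion hκ hx hne heq a ha
  have h0 : κ s - κ a + σ a = 0 := by
    linear_combination σ a * (-h) + (κ a - κ s) * hσ a
  rw [h0, div_eq_zero_iff] at e
  have hσ0 : σ a ≠ 0 := fun h => by
    have := hσ a
    rw [h, zero_mul] at this
    exact zero_ne_one this
  by_contra hA
  exact e.elim (mul_ne_zero hσ0 (hx a ha hA)) (sub_ne_zero.mpr (hne a ha))

/-- The solution as a recursion from the first variable to the last. -/
theorem chain_forward {s : ℕ} {σ A κ x : ℕ → ℂ} (hσ : ∀ a, σ a * σ a = 1)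
    (hκ : ∀ a < s, κ (a + 1) = κ a - A a - σ a)
    (hx : ∀ a < s, A a ≠ 0 → x (a + 1) ≠ 0) (hne : ∀ a < s, x (a + 1) ≠ x a)
    (heq : ∀ a < s, A a / x (a + 1) + σ a / (x (a + 1) - x a) +
      (if a + 1 < s then σ (a + 1) / (x (a + 1) - x (a + 2)) else 0) = 0) (a : ℕ) (ha : a < s) :
    σ a * (κ a - κ s) * x (a + 1) = (σ a * (κ a - κ s) - 1) * x a := by
  have e := chain_recursion hκ hx hne heq a ha
  rw [div_eq_iff (sub_ne_zero.mpr (hne a ha))] at e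
  linear_combination σ a * e - x a * hσ a

/-- A sequence with `m_a x_{a+1} = (m_a - 1) x_a` for integers `m_a ≥ 2` has decreasing absolute
values. -/
theorem chain_norm_lt {s : ℕ} {m : ℕ → ℤ} {x : ℕ → ℂ} (hm : ∀ a < s, 2 ≤ m a) (h0 : x 0 ≠ 0)
    (h : ∀ a < s, (m a : ℂ) * x (a + 1) = ((m a : ℂ) - 1) * x a) :
    ∀ a ≤ s, x a ≠ 0 ∧ ∀ b < a, ‖x a‖ < ‖x b‖ := by
  intro a
  induction a with
  | zero => exact fun _ => ⟨h0, fun b hb => absurd hb (Nat.not_lt_zero b)⟩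
  | succ a ih =>
    intro ha
    obtain ⟨hxa, hlt⟩ := ih (by omega)
    have hma := hm a (by omega)
    have e := h a (by omega)
    have hmR : (2 : ℝ) ≤ m a := by exact_mod_cast hma
    have hcast : ((m a : ℂ) - 1) = ((m a - 1 : ℝ) : ℂ) := by push_cast; rfl
    have hcast' : (m a : ℂ) = ((m a : ℝ) : ℂ) := by push_cast; rfl
    have hne : x (a + 1) ≠ 0 := by
      intro hz
      rw [hz, mul_zero, eq_comm, mul_eq_zero, hcast, Complex.ofReal_eq_zero] at e
      rcases e with e | e
      · linarith
      · exact hxa e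
    refine ⟨hne, ?_⟩
    have hn : (m a : ℝ) * ‖x (a + 1)‖ = (m a - 1) * ‖x a‖ := by
      have := congrArg norm e
      rw [hcast, hcast', norm_mul, norm_mul, Complex.norm_real, Complex.norm_real,
        Real.norm_of_nonneg (by linarith), Real.norm_of_nonneg (by linarith)] at this
      exact this
    have hpos := norm_pos_iff.mpr hxa
    have step : ‖x (a + 1)‖ < ‖x a‖ := by
      by_contra hcon
      nlinarith
    intro b hb
    rcases Nat.lt_succ_iff_lt_or_eq.mp hb with hb | rfl
    · exact step.trans (hlt b hb)
    · exact step

theorem chain_unique {s : ℕ} {m : ℕ → ℤ} {x y : ℕ → ℂ} (hm : ∀ a < s, 2 ≤ m a)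
    (h0 : x 0 = y 0)
    (hx : ∀ a < s, (m a : ℂ) * x (a + 1) = ((m a : ℂ) - 1) * x a)
    (hy : ∀ a < s, (m a : ℂ) * y (a + 1) = ((m a : ℂ) - 1) * y a) : ∀ a ≤ s, x a = y a := by
  intro a
  induction a with
  | zero => exact fun _ => h0
  | succ a ih =>
    intro ha
    have hma : (m a : ℂ) ≠ 0 := by
      have := hm a (by omega)
      exact_mod_cast (by omega : m a ≠ 0)
    refine mul_left_cancel₀ hma ?_
    rw [hx a (by omega), hy a (by omega), ih (by omega)]

section Chain

variable {r L : ℕ} {p : Fin (r + 1) → ZMod 2}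

theorem form_simpleRoot_simpleRoot {a b : Fin r} (hab : a ≠ b) :
    form p (simpleRoot a) (simpleRoot b) =
      (if (b : ℕ) = a + 1 then -sgn (p a.succ) else 0) +
        (if (b : ℕ) + 1 = a then -sgn (p a.castSucc) else 0) := by
  have hab' : (a : ℕ) ≠ b := fun h => hab (Fin.ext h)
  rw [form_simpleRoot]
  simp only [simpleRoot, eps, Pi.sub_apply, Pi.single_apply, Fin.ext_iff, Fin.val_castSucc,
    Fin.val_succ]
  by_cases h1 : (b : ℕ) = a + 1 <;> by_cases h2 : (b : ℕ) + 1 = a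
  · omega
  · rw [if_neg hab', if_neg (by omega), if_pos (by omega), if_neg (by omega), if_pos h1,
      if_neg h2]
    ring
  · rw [if_neg hab', if_pos (by omega), if_neg (by omega), if_neg (by omega), if_neg h1,
      if_pos h2]
    ring
  · rw [if_neg hab', if_neg (by omega), if_neg (by omega), if_neg (by omega), if_neg h1,
      if_neg h2]
    ring

/-- The variables in the order of their colours, in the coordinate centred at the second site, with
the first site at the position `0`. It is meant for colourings without repetition; the value is `0`
if the colour does not occur. -/
def chainVar (z₁ z₂ : ℂ) (c : Fin L → Fin r) (t : Fin L → ℂ) : ℕ → ℂ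
  | 0 => z₁ - z₂
  | a + 1 => open Classical in if h : ∃ i, (c i : ℕ) = a then t h.choose - z₂ else 0

theorem chainVar_succ {z₁ z₂ : ℂ} {c : Fin L → Fin r} (hc : Function.Injective c)
    (t : Fin L → ℂ) (i : Fin L) : chainVar z₁ z₂ c t (c i + 1) = t i - z₂ := by
  have h : ∃ j, (c j : ℕ) = c i := ⟨i, rfl⟩
  have e : h.choose = i := hc (Fin.ext h.choose_spec)
  rw [chainVar, dif_pos h, e]

/-- A function of the index `a` of `e_a`, extended (periodically) to the natural numbers; only the
values at `a ≤ r` matter. -/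
def onNat {X : Type*} (f : Fin (r + 1) → X) (a : ℕ) : X := f (Fin.ofNat (r + 1) a)

theorem onNat_of_lt {X : Type*} (f : Fin (r + 1) → X) {a : ℕ} (h : a < r + 1) :
    onNat f a = f ⟨a, h⟩ :=
  congrArg f (Fin.ext (Nat.mod_eq_of_lt h))

theorem onNat_castSucc {X : Type*} (f : Fin (r + 1) → X) (a : Fin r) :
    onNat f (a : ℕ) = f a.castSucc := onNat_of_lt f (by omega)

theorem onNat_succ {X : Type*} (f : Fin (r + 1) → X) (a : Fin r) :
    onNat f ((a : ℕ) + 1) = f a.succ := onNat_of_lt f (by omega)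

/-- The Bethe equations in the coordinates `chainVar`: the first site plays the role of a variable
before the first colour, since `(α_0, ε_0) = (-1)^{|e_0|}`, counting from zero. -/
theorem IsBetheSolution.chain {lam : Fin (r + 1) → ℂ} {z₁ z₂ : ℂ} {c : Fin L → Fin r}
    {t : Fin L → ℂ} (hB : IsBetheSolution p (eps 0) lam z₁ z₂ c t)
    (hc : Function.Injective c) {s : ℕ} (hlt : ∀ i, (c i : ℕ) < s)
    (hsurj : ∀ a < s, ∃ i, (c i : ℕ) = a) :
    let σ := onNat fun a => sgn (p a)
    let A := fun a => onNat (fun a => sgn (p a) * lam a) a - onNat (fun a => sgn (p a) * lam a) (a + 1)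
    let x := chainVar z₁ z₂ c t
    (∀ a < s, A a ≠ 0 → x (a + 1) ≠ 0) ∧ (∀ a < s, x (a + 1) ≠ x a) ∧
    ∀ a < s, A a / x (a + 1) + σ a / (x (a + 1) - x a) +
      (if a + 1 < s then σ (a + 1) / (x (a + 1) - x (a + 2)) else 0) = 0 := by
  intro σ A x
  have hxi : ∀ i, x (c i + 1) = t i - z₂ := fun i => chainVar_succ hc t i
  have hA : ∀ i, A (c i) = form p (simpleRoot (c i)) lam := by
    intro i
    simp only [A, onNat_castSucc, onNat_succ]
    rw [form_simpleRoot]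
  have hσ : ∀ i, σ (c i) = sgn (p (c i).castSucc) := fun i => onNat_castSucc _ _
  have hσ' : ∀ i, σ (c i + 1) = sgn (p (c i).succ) := fun i => onNat_succ _ _
  have hsite : ∀ i, form p (simpleRoot (c i)) (eps 0) =
      if (c i : ℕ) = 0 then σ (c i) else 0 := by
    intro i
    rw [form_simpleRoot, hσ]
    have h1 : (c i).succ ≠ 0 := Fin.succ_ne_zero _
    by_cases h : (c i : ℕ) = 0
    · have h2 : (c i).castSucc = 0 := Fin.ext h
      simp [eps, h1, h2, h]
    · have h2 : (c i).castSucc ≠ 0 := fun h' => h (congrArg Fin.val h')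
      simp [eps, h1, h2, h]
  refine ⟨fun a ha hAa => ?_, fun a ha => ?_, fun a ha => ?_⟩
  · obtain ⟨i, rfl⟩ := hsurj a ha
    rw [hxi, sub_ne_zero]
    exact hB.ne_site₂ i (by rwa [← hA])
  · obtain ⟨i, hi⟩ := hsurj a ha
    rcases a with _ | a
    · have h := hB.ne_site₁ i (by rw [hsite, if_pos hi, hσ]; exact sgn_ne_zero _)
      rw [← hi, hxi, hi]
      change _ ≠ z₁ - z₂
      exact fun h' => h (sub_left_injective h')
    · obtain ⟨j, hj⟩ := hsurj a (by omega)
      have hij : i ≠ j := by rintro rfl; omega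
      have h := hB.ne_root i j hij (by
        rw [form_simpleRoot_simpleRoot (fun h => hij (hc h)), if_neg (by omega),
          if_pos (by omega), zero_add]
        exact neg_ne_zero.mpr (sgn_ne_zero _))
      rw [← hi, hxi, hi, ← hj, hxi]
      exact fun h' => h (sub_left_injective h')
  · obtain ⟨i, hi⟩ := hsurj a ha
    have e := hB.equation i
    have hsum : ∑ j ∈ Finset.univ.erase i,
        form p (simpleRoot (c i)) (simpleRoot (c j)) / (t i - t j) =
        ∑ b ∈ (Finset.range s).erase a, ((if b = a + 1 then -σ (a + 1) else 0) +
          (if b + 1 = a then -σ a else 0)) / (x (a + 1) - x (b + 1)) := by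
      refine Finset.sum_nbij (fun j => (c j : ℕ)) (fun j hj => ?_) (fun j _ k _ h => ?_)
        (fun b hb => ?_) fun j hj => ?_
      · refine Finset.mem_erase.mpr ⟨fun h => ?_, Finset.mem_range.mpr (hlt j)⟩
        exact (Finset.mem_erase.mp hj).1 (hc (Fin.ext (h.trans hi.symm)))
      · exact hc (Fin.ext h)
      · obtain ⟨hba, hb⟩ := Finset.mem_erase.mp hb
        obtain ⟨j, hj⟩ := hsurj b (Finset.mem_range.mp hb)
        refine ⟨j, Finset.mem_coe.mpr (Finset.mem_erase.mpr ⟨?_, Finset.mem_univ j⟩), hj⟩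
        rintro rfl
        exact hba (hj.symm.trans hi)
      · have hij : c i ≠ c j := fun h => (Finset.mem_erase.mp hj).1 (hc h.symm)
        rw [form_simpleRoot_simpleRoot hij, ← hi, hxi, hxi, hσ, hσ']
        congr 1
        ring
    have hnext : ∑ b ∈ (Finset.range s).erase a,
        (if b = a + 1 then -σ (a + 1) else 0) / (x (a + 1) - x (b + 1)) =
        -(if a + 1 < s then σ (a + 1) / (x (a + 1) - x (a + 2)) else 0) := by
      have h1 : ∀ b, (if b = a + 1 then -σ (a + 1) else 0) / (x (a + 1) - x (b + 1)) =
          if b = a + 1 then -(σ (a + 1) / (x (a + 1) - x (a + 2))) else 0 := by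
        intro b
        split_ifs with h
        · rw [h, neg_div]
        · rw [zero_div]
      simp only [h1]
      rw [Finset.sum_ite_eq']
      simp only [Finset.mem_erase, Finset.mem_range, ne_eq, Nat.succ_ne_self, not_false_eq_true,
        true_and]
      split_ifs <;> simp
    have hprev : ∑ b ∈ (Finset.range s).erase a,
        (if b + 1 = a then -σ a else 0) / (x (a + 1) - x (b + 1)) =
        if a = 0 then 0 else -(σ a / (x (a + 1) - x a)) := by
      rcases a with _ | a
      · simp
      · have h1 : ∀ b, (if b + 1 = a + 1 then -σ (a + 1) else 0) / (x (a + 1 + 1) - x (b + 1)) =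
            if b = a then -(σ (a + 1) / (x (a + 1 + 1) - x (a + 1))) else 0 := by
          intro b
          simp only [Nat.add_right_cancel_iff]
          split_ifs with h
          · rw [h, neg_div]
          · rw [zero_div]
        simp only [h1]
        rw [Finset.sum_ite_eq', if_pos, if_neg (Nat.succ_ne_zero a)]
        exact Finset.mem_erase.mpr ⟨by omega, Finset.mem_range.mpr (by omega)⟩
    simp only [add_div, Finset.sum_add_distrib] at hsum
    rw [hsum, hnext, hprev, hsite, ← hA, ← hxi, hi] at e
    have hz : t i - z₁ = x (a + 1) - x 0 := by
      rw [← hi, hxi]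
      change _ = _ - (z₁ - z₂)
      ring
    rw [hz] at e
    by_cases h0 : a = 0
    · subst h0
      simp only [if_true] at e
      linear_combination -e
    · rw [if_neg h0, if_neg h0] at e
      linear_combination -e

end Chain

end

/-! ### Bethe vectors -/

section

variable {r L : ℕ} {p : Fin (r + 1) → ZMod 2}

theorem hookWeight_eq (μ : YoungDiagram) (a : Fin (r + 1)) :
    hookWeight p μ a = (hookNat p μ a : ℂ) := rfl

theorem sgn_eq_sgnInt (x : ZMod 2) : sgn x = (sgnInt x : ℂ) := by
  by_cases h : x = 0 <;> simp [sgn, sgnInt, h]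

theorem sum_sgn_lt_succ (a : Fin r) : ∑ d ∈ Finset.univ.filter (· < a.succ), sgn (p d) =
    ∑ d ∈ Finset.univ.filter (· < a.castSucc), sgn (p d) + sgn (p a.castSucc) := by
  have h : (Finset.univ.filter (· < a.succ)) =
      insert a.castSucc (Finset.univ.filter (· < a.castSucc)) := by
    ext b
    simp only [Finset.mem_filter, Finset.mem_univ, true_and, Finset.mem_insert]
    rw [← Fin.le_castSucc_iff, le_iff_eq_or_lt]
  rw [h, Finset.sum_insert (by simp), add_comm]

theorem content_hookWeight (μ : YoungDiagram) (b : Fin (r + 1)) :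
    content p (hookWeight p μ) b = (hookContent p μ b : ℂ) := by
  have h : ∑ d ∈ Finset.univ.filter (· < b), sgn (p d) =
      (before p 0 b : ℂ) - before p 1 b := by
    induction b using Fin.induction with
    | zero => simp [before_zero]
    | succ b ih =>
      rw [sum_sgn_lt_succ, ih, before_succ, before_succ]
      rcases parity_cases (p b.castSucc) with h | h <;> rw [h] <;> simp [sgn] <;> ring
  rw [content, h, hookContent, hookWeight_eq, sgn_eq_sgnInt]
  push_cast
  ring

theorem content_succ (lam : Fin (r + 1) → ℂ) (a : Fin r) : content p lam a.succ =
    content p lam a.castSucc -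
      (sgn (p a.castSucc) * lam a.castSucc - sgn (p a.succ) * lam a.succ) -
      sgn (p a.castSucc) := by
  rw [content, content, sum_sgn_lt_succ]
  ring

/-- The difference of the contents at `a` and `s`, with the sign of the parity of `e_a`. -/
def contentGap (p : Fin (r + 1) → ZMod 2) (μ : YoungDiagram) (s : Fin (r + 1)) : ℕ → ℤ :=
  onNat fun a => sgnInt (p a) * (hookContent p μ a - hookContent p μ s)

/-- Solutions of the Bethe equations with one variable of each of the colours `0, …, s - 1` obey a
recursion whose coefficients are differences of contents. -/
theorem IsBetheSolution.forward {μ : YoungDiagram} {z₁ z₂ : ℂ} {c : Fin L → Fin r}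
    {t : Fin L → ℂ} (hB : IsBetheSolution p (eps 0) (hookWeight p μ) z₁ z₂ c t)
    (hc : Function.Injective c) {s : Fin (r + 1)} (hlt : ∀ i, (c i : ℕ) < s)
    (hsurj : ∀ a < (s : ℕ), ∃ i, (c i : ℕ) = a) :
    ∀ a < (s : ℕ), 2 ≤ contentGap p μ s a ∧
      (contentGap p μ s a : ℂ) *
          chainVar z₁ z₂ c t (a + 1) =
        ((contentGap p μ s a : ℂ) - 1) *
          chainVar z₁ z₂ c t a := by
  obtain ⟨hx, hne, heq⟩ := hB.chain hc hlt hsurj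
  set m := contentGap p μ s with hm
  set σ := onNat fun a => sgn (p a) with hσ
  set A : ℕ → ℂ := fun a => onNat (fun a => sgn (p a) * hookWeight p μ a) a -
    onNat (fun a => sgn (p a) * hookWeight p μ a) (a + 1) with hA
  set κ := onNat (content p (hookWeight p μ)) with hκ
  have hσσ : ∀ a, σ a * σ a = 1 := fun a => sgn_mul_self _
  have hs := s.isLt
  have hκA : ∀ a < (s : ℕ), κ (a + 1) = κ a - A a - σ a := by
    intro a ha
    have e1 : κ (a + 1) = _ := onNat_succ _ ⟨a, by omega⟩
    have e2 : κ a = _ := onNat_castSucc _ ⟨a, by omega⟩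
    have e3 : σ a = _ := onNat_castSucc _ ⟨a, by omega⟩
    have e4 : A a = _ :=
      congrArg₂ HSub.hSub (onNat_castSucc _ ⟨a, by omega⟩) (onNat_succ _ ⟨a, by omega⟩)
    rw [e1, e2, e3, e4, content_succ]
  have hms : ∀ a, (m a : ℂ) = σ a * (κ a - κ s) := by
    intro a
    have h1 : κ s = hookContent p μ s := by
      rw [hκ, onNat_of_lt _ hs, content_hookWeight]
    rw [h1, hκ, hσ, hm]
    simp only [contentGap, onNat]
    rw [content_hookWeight, sgn_eq_sgnInt]
    push_cast
    ring
  have hroot : ∀ a : Fin r, A a = (hookRoot p μ a : ℂ) := by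
    intro a
    simp only [hA]
    rw [onNat_castSucc, onNat_succ, hookRoot, hookWeight_eq, hookWeight_eq, sgn_eq_sgnInt,
      sgn_eq_sgnInt]
    push_cast
    ring
  intro a ha
  refine ⟨?_, ?_⟩
  · obtain ⟨s', rfl⟩ := Fin.exists_succ_eq_of_ne_zero (show s ≠ 0 by rintro rfl; simp at ha)
    have key := two_le_content_sub (p := p) (μ := μ) (s := s') ?_ ?_ (a := ⟨a, by omega⟩)
      (Fin.le_def.mpr (Nat.lt_succ_iff.mp ha))
    · have e : m a = _ := onNat_castSucc _ ⟨a, by omega⟩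
      rw [e]
      exact key
    · have := chain_last_ne_zero (fun a => sgn_ne_zero _) hne heq s' rfl
      rw [hroot] at this
      exact_mod_cast this
    · intro b hb h
      have h' : m b = 1 := by
        rw [hm, contentGap, onNat_castSucc]
        exact h
      have := chain_coefficient_eq_zero hσσ hκA hx hne heq b
        (Nat.lt_succ_of_lt hb) (by rw [← hms, h']; simp)
      rw [hroot] at this
      exact_mod_cast this
  · rw [hms]
    exact chain_forward hσσ hκA hx hne heq a ha

theorem chainVar_zero_ne_zero {z₁ z₂ : ℂ} (hz : z₁ ≠ z₂) (c : Fin L → Fin r) (t : Fin L → ℂ) :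
    chainVar z₁ z₂ c t 0 ≠ 0 := sub_ne_zero.mpr hz

theorem IsBetheSolution.isRegular {μ : YoungDiagram} {z₁ z₂ : ℂ} (hz : z₁ ≠ z₂)
    {c : Fin L → Fin r} {t : Fin L → ℂ}
    (hB : IsBetheSolution p (eps 0) (hookWeight p μ) z₁ z₂ c t)
    (hc : Function.Injective c) {s : Fin (r + 1)} (hlt : ∀ i, (c i : ℕ) < s)
    (hsurj : ∀ a < (s : ℕ), ∃ i, (c i : ℕ) = a) : IsRegular z₁ z₂ t := by
  have hf := hB.forward hc hlt hsurj
  have hn := chain_norm_lt (fun a ha => (hf a ha).1) (chainVar_zero_ne_zero hz c t)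
    fun a ha => (hf a ha).2
  have hx := fun i => chainVar_succ (z₁ := z₁) (z₂ := z₂) hc t i
  refine ⟨fun i j hij => ?_, fun i => ⟨?_, ?_⟩⟩
  · have e : chainVar z₁ z₂ c t (c i + 1) = chainVar z₁ z₂ c t (c j + 1) := by
      rw [hx, hx, hij]
    rcases lt_trichotomy (c i : ℕ) (c j) with h | h | h
    · have := (hn _ (hlt j)).2 _ (Nat.succ_lt_succ h)
      rw [Nat.succ_eq_add_one, Nat.succ_eq_add_one, e] at this
      exact absurd this (lt_irrefl _)
    · exact hc (Fin.ext h)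
    · have := (hn _ (hlt i)).2 _ (Nat.succ_lt_succ h)
      rw [Nat.succ_eq_add_one, Nat.succ_eq_add_one, e] at this
      exact absurd this (lt_irrefl _)
  · intro h
    have := (hn _ (hlt i)).2 0 (Nat.succ_pos _)
    rw [Nat.succ_eq_add_one, hx, h] at this
    exact absurd this (lt_irrefl _)
  · intro h
    have := (hn _ (hlt i)).1
    rw [Nat.succ_eq_add_one, hx, h, sub_self] at this
    exact this rfl

/-- A Bethe solution with one variable of each of the colours `0, …, s - 1` is unique. -/
theorem IsBetheSolution.unique {μ : YoungDiagram} {z₁ z₂ : ℂ}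
    {c : Fin L → Fin r} {t t' : Fin L → ℂ}
    (hB : IsBetheSolution p (eps 0) (hookWeight p μ) z₁ z₂ c t)
    (hB' : IsBetheSolution p (eps 0) (hookWeight p μ) z₁ z₂ c t')
    (hc : Function.Injective c) {s : Fin (r + 1)} (hlt : ∀ i, (c i : ℕ) < s)
    (hsurj : ∀ a < (s : ℕ), ∃ i, (c i : ℕ) = a) : t = t' := by
  have hf := hB.forward hc hlt hsurj
  have hf' := hB'.forward hc hlt hsurj
  funext i
  have := chain_unique (fun a ha => (hf a ha).1)
    (show chainVar z₁ z₂ c t 0 = chainVar z₁ z₂ c t' 0 from rfl) (fun a ha => (hf a ha).2)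
    (fun a ha => (hf' a ha).2) (c i + 1) (hlt i)
  rw [chainVar_succ hc, chainVar_succ hc] at this
  exact sub_left_injective this

theorem colouring_of_ones {c : Fin L → Fin r} {l : Fin r → ℕ}
    (hc : ∀ a, (Finset.univ.filter fun i => c i = a).card = l a) {s : ℕ} (hs : s ≤ r)
    (hl : ∀ a : Fin r, l a = if (a : ℕ) < s then 1 else 0) :
    Function.Injective c ∧ (∀ i, (c i : ℕ) < s) ∧ ∀ a < s, ∃ i, (c i : ℕ) = a := by
  refine ⟨fun i j hij => ?_, fun i => ?_, fun a ha => ?_⟩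
  · have hcard : (Finset.univ.filter fun k => c k = c i).card ≤ 1 := by
      rw [hc, hl]
      split_ifs <;> omega
    exact Finset.card_le_one.mp hcard i (by simp) j (by simp [hij])
  · by_contra h
    have h0 := hc (c i)
    rw [hl, if_neg h, Finset.card_eq_zero, Finset.filter_eq_empty_iff] at h0
    exact h0 (Finset.mem_univ i) rfl
  · have h1 := hc ⟨a, by omega⟩
    rw [hl, if_pos ha] at h1
    obtain ⟨i, hi⟩ := Finset.card_pos.mp (by rw [h1]; exact one_pos)
    exact ⟨i, congrArg Fin.val (Finset.mem_filter.mp hi).2⟩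

theorem gr_e₁ (hp : p 0 = 0) : (defining p).gr (e₁ r) = e₁ r := by
  ext a
  by_cases h : a = 0
  · subst h; simp [defining, e₁, hp, sgn]
  · simp [defining, e₁, h]

/-- The sum of the coordinates up to `a` counts the simple root `α_a` and no other one. -/
theorem colour_count_of_weight {c : Fin L → Fin r} {l : Fin r → ℕ}
    (hc : ∀ a, (Finset.univ.filter fun i => c i = a).card = l a) {lam : Fin (r + 1) → ℂ}
    {b : Fin (r + 1)}
    (h : (fun a => eps 0 a + lam a - ∑ i, simpleRoot (c i) a) = lam + eps b) (a : Fin r) :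
    l a = if (a : ℕ) < b then 1 else 0 := by
  have hsum : ∀ d : Fin (r + 1), ∑ x ∈ Finset.univ.filter (· ≤ a.castSucc), eps d x =
      if d ≤ a.castSucc then 1 else 0 := by
    intro d
    simp [eps, Pi.single_apply]
  have hroot : ∀ i : Fin r, ∑ x ∈ Finset.univ.filter (· ≤ a.castSucc), simpleRoot i x =
      if i = a then 1 else 0 := by
    intro i
    simp only [simpleRoot, Pi.sub_apply, Finset.sum_sub_distrib, hsum]
    simp only [Fin.le_def, Fin.val_castSucc, Fin.val_succ, Fin.ext_iff]
    split_ifs <;> first | omega | simp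
  have e := congrArg (fun f : Fin (r + 1) → ℂ =>
    ∑ x ∈ Finset.univ.filter (· ≤ a.castSucc), f x) h
  simp only [Pi.add_apply, Finset.sum_add_distrib, Finset.sum_sub_distrib] at e
  rw [Finset.sum_comm] at e
  simp only [hroot, hsum, Fin.zero_le, if_true, Finset.sum_boole, hc] at e
  have hba : (b ≤ a.castSucc) ↔ ¬ ((a : ℕ) < b) := by rw [Fin.le_def, not_lt]; rfl
  by_cases hab : (a : ℕ) < b
  · rw [if_neg (by rw [hba]; exact not_not.mpr hab)] at e
    rw [if_pos hab]
    have : (l a : ℂ) = 1 := by linear_combination -e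
    exact_mod_cast this
  · rw [if_pos (hba.mpr hab)] at e
    rw [if_neg hab]
    have : (l a : ℂ) = 0 := by linear_combination -e
    exact_mod_cast this

/-- A Bethe vector is an eigenvector of the Casimir operator, and it has one variable of each of
the colours `0, …, b - 1`. -/
theorem bethe_vector {μ : YoungDiagram} (hp : p 0 = 0) {V : Type*} [AddCommGroup V] [Module ℂ V]
    {M : GLModule p V} {v : V} (hM : IsIrreducibleHighestWeight M (hookWeight p μ) v)
    {z₁ z₂ : ℂ} {c : Fin L → Fin r} {l : Fin r → ℕ}
    (hc : ∀ a, (Finset.univ.filter fun i => c i = a).card = l a) {t : Fin L → ℂ}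
    (hB : IsBetheSolution p (eps 0) (hookWeight p μ) z₁ z₂ c t) (ht : IsRegular z₁ z₂ t)
    (hw : weightFunction (defining p) M (e₁ r) v z₁ z₂ c t ≠ 0) :
    ∃ b : Fin (r + 1), (∀ a : Fin r, l a = if (a : ℕ) < b then 1 else 0) ∧
      (gaudin₁ (defining p) M z₁ z₂).HasEigenvector
        (1 / (z₁ - z₂) * (hookContent p μ b : ℂ))
        (weightFunction (defining p) M (e₁ r) v z₁ z₂ c t) := by
  have hw' := weightFunction_eq_outerSum (defining p) M v (gr_e₁ hp) z₁ z₂ c t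
  have h₁ := site₁_self_e₁_tmul M v
  have h₂ : ∀ a, site₂ (defining p) M a a (e₁ r ⊗ₜ[ℂ] v) =
      hookWeight p μ a • (e₁ r ⊗ₜ[ℂ] v) := by
    intro a
    rw [site₂_eq, add_self_eq_zero', TensorProduct.map_tmul, hM.weight, TensorProduct.tmul_smul]
    rfl
  have hu : ∀ a : Fin r, diag (defining p) M a.castSucc a.succ (e₁ r ⊗ₜ[ℂ] v) = 0 := by
    intro a
    refine comp_ext fun b => ?_
    rw [comp_diag, comp_tmul, comp_tmul, map_smul, hM.raising _ _ a.castSucc_lt_succ]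
    simp [e₁]
  obtain ⟨b, hb, hcas⟩ := casimir_eigenvector hM hw
    (κ := fun a => eps 0 a + hookWeight p μ a - ∑ i, simpleRoot (c i) a)
    (fun a => by rw [hw']; exact weight_outerSum _ M h₁ h₂ a Finset.univ 1 0)
    (fun a b hab => by rw [hw']; exact raise_outerSum_eq_zero _ M hB ht h₁ h₂ hu hab)
  refine ⟨b, colour_count_of_weight hc hb, ?_, hw⟩
  rw [Module.End.mem_eigenspace_iff, gaudin₁_eq_casimir, LinearMap.smul_apply, hcas,
    content_hookWeight, smul_smul]

theorem hookContent_ne_of_lt {μ : YoungDiagram} {z₁ z₂ : ℂ} {c : Fin L → Fin r} {l : Fin r → ℕ}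
    (hc : ∀ a, (Finset.univ.filter fun i => c i = a).card = l a) {t : Fin L → ℂ}
    (hB : IsBetheSolution p (eps 0) (hookWeight p μ) z₁ z₂ c t) {a b : Fin (r + 1)}
    (hl : ∀ a : Fin r, l a = if (a : ℕ) < b then 1 else 0) (hab : a < b) :
    hookContent p μ a ≠ hookContent p μ b := by
  obtain ⟨inj, hlt, hsurj⟩ := colouring_of_ones hc (Nat.lt_succ_iff.mp b.isLt) hl
  have := (hB.forward inj hlt hsurj a hab).1
  rw [contentGap, onNat_of_lt _ a.isLt] at this
  intro h
  simp [h] at this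

end

end SuperGaudin

end

open SuperGaudin in
theorem proposition4p4 {m n r : ℕ} (p : Fin (r + 1) → ZMod 2)
    (hm : (Finset.univ.filter fun a => p a = 0).card = m)
    (hn : (Finset.univ.filter fun a => p a = 1).card = n)
    (hp : p 0 = 0)
    -- a hook diagram: no box in row `m + 1`, column `n + 1` (positions are counted from zero)
    (μ : YoungDiagram) (hμ : (m, n) ∉ μ.cells)
    -- the polynomial module `V(μ)` and a highest weight vector of it
    {V : Type*} [AddCommGroup V] [Module ℂ V] (M : GLModule p V) (v : V)
    (hM : IsIrreducibleHighestWeight M (hookWeight p μ) v)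
    (z₁ z₂ : ℂ) (hz : z₁ ≠ z₂)
    -- for each `l`, a colouring of the variables that uses the colour `a` exactly `l a` times
    (c : (l : Fin r → ℕ) → Fin (∑ a, l a) → Fin r)
    (hc : ∀ l a, (Finset.univ.filter fun i => c l i = a).card = l a) :
    gaudin₁ (defining p) M z₁ z₂ = -gaudin₂ (defining p) M z₁ z₂ ∧
    -- solutions with one variable of each of the colours `1, …, s` have a Bethe vector
    (∀ (l : Fin r → ℕ) (t : Fin (∑ a, l a) → ℂ),
      IsBetheSolution p (eps 0) (hookWeight p μ) z₁ z₂ (c l) t →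
      (∃ s : ℕ, s ≤ r ∧ ∀ a : Fin r, l a = if (a : ℕ) < s then 1 else 0) →
      IsRegular z₁ z₂ t ∧ weightFunction (defining p) M (e₁ r) v z₁ z₂ (c l) t ≠ 0) ∧
    -- Bethe vectors of distinct solutions are eigenvectors with distinct eigenvalues
    (∀ (l l' : Fin r → ℕ) (t : Fin (∑ a, l a) → ℂ) (t' : Fin (∑ a, l' a) → ℂ),
      IsBetheSolution p (eps 0) (hookWeight p μ) z₁ z₂ (c l) t → IsRegular z₁ z₂ t →
      weightFunction (defining p) M (e₁ r) v z₁ z₂ (c l) t ≠ 0 →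
      IsBetheSolution p (eps 0) (hookWeight p μ) z₁ z₂ (c l') t' → IsRegular z₁ z₂ t' →
      weightFunction (defining p) M (e₁ r) v z₁ z₂ (c l') t' ≠ 0 →
      (⟨l, t⟩ : (l : Fin r → ℕ) × (Fin (∑ a, l a) → ℂ)) ≠ ⟨l', t'⟩ →
      ∃ E E' : ℂ,
        (gaudin₁ (defining p) M z₁ z₂).HasEigenvector E
          (weightFunction (defining p) M (e₁ r) v z₁ z₂ (c l) t) ∧
        (gaudin₁ (defining p) M z₁ z₂).HasEigenvector E'
          (weightFunction (defining p) M (e₁ r) v z₁ z₂ (c l') t') ∧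
        E ≠ E') := by
  refine ⟨gaudin₁_eq_neg_gaudin₂ _ M z₁ z₂, ?_, ?_⟩
  · rintro l t hB ⟨s, hs, hl⟩
    obtain ⟨inj, hlt, hsurj⟩ := colouring_of_ones (hc l) hs hl
    have hreg := hB.isRegular hz inj (s := ⟨s, Nat.lt_succ_of_le hs⟩) hlt hsurj
    refine ⟨hreg, fun h => ?_⟩
    obtain ⟨k, hk, hcomp⟩ := comp_outerSum M v hreg inj s (Nat.lt_succ_of_le hs) Finset.univ
      (fun i _ => hlt i)
      (fun a ha => (hsurj a ha).imp fun i hi => ⟨Finset.mem_univ i, hi⟩) 1 0 (by simp) (by simp)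
    rw [← weightFunction_eq_outerSum (defining p) M v (gr_e₁ hp), h, map_zero] at hcomp
    exact smul_ne_zero hk hM.ne_zero hcomp.symm
  · intro l l' t t' hB ht hw hB' ht' hw' hne
    obtain ⟨b, hl, hE⟩ := bethe_vector hp hM (hc l) hB ht hw
    obtain ⟨b', hl', hE'⟩ := bethe_vector hp hM (hc l') hB' ht' hw'
    refine ⟨_, _, hE, hE', ?_⟩
    have hz' : 1 / (z₁ - z₂) ≠ 0 := one_div_ne_zero (sub_ne_zero.mpr hz)
    suffices h : hookContent p μ b ≠ hookContent p μ b' from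
      fun e => h (by exact_mod_cast mul_left_cancel₀ hz' e)
    rcases lt_trichotomy b b' with hlt | rfl | hlt
    · exact hookContent_ne_of_lt (hc l') hB' hl' hlt
    · obtain rfl : l = l' := funext fun a => (hl a).trans (hl' a).symm
      obtain ⟨inj, hlt, hsurj⟩ := colouring_of_ones (hc l) (Nat.lt_succ_iff.mp b.isLt) hl
      exact absurd (by rw [hB.unique hB' inj hlt hsurj]) hne
    · exact (hookContent_ne_of_lt (hc l) hB hl hlt).symm
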